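/- A ribbon graph with $e\ge 1$ edges is a triple $\Gamma=(H,\alpha,\sigma)$, where $H=\{1,\dots,2e\}$ is the set of half-edges and $\alpha,\sigma$ are permutations of $H$ such that $\alpha$ is a fixed-point-free involution and the group generated by $\alpha$ and $\sigma$ acts transitively on $H$. Its vertices are the cycles of $\sigma$ and its faces are the cycles of $\sigma^{-1}\circ\alpha$ (fixed points count as cycles of length one). The degree of a vertex is the length of the cycle. If $\Gamma$ has $n$ vertices and $f$ faces, its genus $g$ is defined by $n-e+f=2-2g$. A marked graph is a ribbon graph whose $n$ vertices are labelled bijectively by $1,\dots,n$. A marked isomorphism between two marked graphs is a permutation $\psi$ of $H$ that intertwines the two involutions $\alpha$ and the two permutations $\sigma$ and preserves the labels of the vertices; isomorphic marked graphs are identified. $\mathrm{Aut}_v(\Gamma_v)$ denotes the group of marked isomorphisms from a marked graph $\Gamma_v$ to itself. For positive integers $\mu_1,\dots,\mu_n$ let $G_{g,n}(\mu_1,\dots,\mu_n)$ be the set of distinct marked graphs of genus $g$ with $n$ vertices in which the vertex labelled $i$ has degree $\mu_i$, and put $$C_{g,n}(\mu_1,\dots,\mu_n)=\mu_1\cdots\mu_n\sum_{\Gamma_v\in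 G_{g,n}(\mu_1,\dots,\mu_n)}\frac{1}{|\mathrm{Aut}_v(\Gamma_v)|}.$$ Then for all positive integers $\mu_1,\mu_2,\mu_3$, $$C_{0,3}(\mu_1,\mu_2,\mu_3)=\frac12\Bigl(1+(-1)^{\mu_1+\mu_2+\mu_3}\Bigr)\,g(\mu_1)\,g(\mu_2)\,g(\mu_3),$$ where $$g(\mu)=2^{[\mu/2]}\,\frac{\bigl(2[\tfrac{\mu-1}{2}]+1\bigr)!!}{[\tfrac{\mu-1}{2}]!}$$ and $[x]$ denotes the integer part of $x$. -/

import Mathlib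

/-- A connected ribbon graph with `e` edges: the half-edges are the elements of `Fin (2 * e)`,
`α` pairs the two half-edges of each edge, and `σ` is the cyclic order of half-edges at the
vertices. -/
structure RibbonGraph (e : ℕ) where
  /-- the fixed-point-free involution whose transpositions are the edges -/
  α : Equiv.Perm (Fin (2 * e))
  /-- the permutation whose cycles are the vertices -/
  σ : Equiv.Perm (Fin (2 * e))
  edges_pos : 0 < e
  α_involutive : ∀ h, α (α h) = h
  α_no_fixed_point : ∀ h, α h ≠ h
  transitive : MulAction.IsPretransitive (Subgroup.closure {α, σ}) (Fin (2 * e))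

/-- The cycles of a permutation, a fixed point being a cycle of length one. -/
abbrev PermCycles {H : Type} (π : Equiv.Perm H) : Type :=
  Quotient (Equiv.Perm.SameCycle.setoid π)

namespace RibbonGraph

/-- The vertices are the cycles of `σ`. -/
abbrev Vertex {e : ℕ} (Γ : RibbonGraph e) : Type := PermCycles Γ.σ

/-- The faces are the cycles of `σ⁻¹ ∘ α`. -/
abbrev Face {e : ℕ} (Γ : RibbonGraph e) : Type := PermCycles (Γ.σ⁻¹ * Γ.α)

/-- The vertex to which a half-edge is incident. -/
def vertexOf {e : ℕ} (Γ : RibbonGraph e) (h : Fin (2 * e)) : Γ.Vertex :=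
  Quotient.mk (Equiv.Perm.SameCycle.setoid Γ.σ) h

/-- `Γ` has genus `g`: (number of vertices) - (number of edges) + (number of faces) `= 2 - 2g`. -/
def HasGenus {e : ℕ} (Γ : RibbonGraph e) (g : ℕ) : Prop :=
  (Nat.card Γ.Vertex : ℤ) - (e : ℤ) + (Nat.card Γ.Face : ℤ) = 2 - 2 * (g : ℤ)

end RibbonGraph

/-- A marked graph: a ribbon graph whose `n` vertices are labelled bijectively by `Fin n`. -/
structure MarkedGraph (e n : ℕ) extends RibbonGraph e where
  mark : toRibbonGraph.Vertex ≃ Fin n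

namespace MarkedGraph

/-- The label of the vertex to which the half-edge `h` is incident. -/
def label {e n : ℕ} (Γ : MarkedGraph e n) (h : Fin (2 * e)) : Fin n :=
  Γ.mark (Γ.vertexOf h)

/-- The degree of the vertex labelled `i`: the number of half-edges incident to it. -/
noncomputable def degree {e n : ℕ} (Γ : MarkedGraph e n) (i : Fin n) : ℕ :=
  Nat.card {h : Fin (2 * e) // Γ.label h = i}

/-- A relabelling `ψ` of the half-edges is a marked isomorphism from `Γ` to `Γ'` if it is an
isomorphism of ribbon graphs that respects the labels of the vertices. -/
def IsMarkedIso {e n : ℕ} (Γ Γ' : MarkedGraph e n) (ψ : Equiv.Perm (Fin (2 * e))) : Prop :=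
  Γ'.α * ψ = ψ * Γ.α ∧ Γ'.σ * ψ = ψ * Γ.σ ∧ ∀ h, Γ'.label (ψ h) = Γ.label h

theorem IsMarkedIso.refl {e n : ℕ} (Γ : MarkedGraph e n) : IsMarkedIso Γ Γ 1 :=
  ⟨by simp, by simp, fun _ => rfl⟩

theorem IsMarkedIso.symm {e n : ℕ} {Γ Γ' : MarkedGraph e n} {ψ : Equiv.Perm (Fin (2 * e))}
    (h : IsMarkedIso Γ Γ' ψ) : IsMarkedIso Γ' Γ ψ⁻¹ := by
  obtain ⟨h1, h2, h3⟩ := h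
  refine ⟨?_, ?_, fun x => ?_⟩
  · rw [eq_inv_mul_iff_mul_eq, ← mul_assoc, ← h1, mul_assoc, mul_inv_cancel, mul_one]
  · rw [eq_inv_mul_iff_mul_eq, ← mul_assoc, ← h2, mul_assoc, mul_inv_cancel, mul_one]
  · rw [← h3, ← Equiv.Perm.mul_apply, mul_inv_cancel, Equiv.Perm.one_apply]

theorem IsMarkedIso.trans {e n : ℕ} {Γ Γ' Γ'' : MarkedGraph e n}
    {ψ φ : Equiv.Perm (Fin (2 * e))} (h : IsMarkedIso Γ Γ' ψ) (h' : IsMarkedIso Γ' Γ'' φ) :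
    IsMarkedIso Γ Γ'' (φ * ψ) := by
  obtain ⟨h1, h2, h3⟩ := h
  obtain ⟨k1, k2, k3⟩ := h'
  refine ⟨?_, ?_, fun x => ?_⟩
  · rw [← mul_assoc, k1, mul_assoc, h1, mul_assoc]
  · rw [← mul_assoc, k2, mul_assoc, h2, mul_assoc]
  · rw [Equiv.Perm.mul_apply, k3, h3]

/-- The group of marked automorphisms: the automorphisms of the ribbon graph that fix every
vertex. -/
def autV {e n : ℕ} (Γ : MarkedGraph e n) : Subgroup (Equiv.Perm (Fin (2 * e))) where
  carrier := {ψ | IsMarkedIso Γ Γ ψ}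
  mul_mem' := fun ha hb => hb.trans ha
  one_mem' := IsMarkedIso.refl Γ
  inv_mem' := fun ha => ha.symm

theorem card_autV_eq {e n : ℕ} {Γ Γ' : MarkedGraph e n} {ψ : Equiv.Perm (Fin (2 * e))}
    (h : IsMarkedIso Γ Γ' ψ) : Nat.card Γ.autV = Nat.card Γ'.autV := by
  refine Nat.card_congr
    ⟨fun φ => ⟨ψ * φ.1 * ψ⁻¹, ?_⟩, fun φ => ⟨ψ⁻¹ * φ.1 * ψ, ?_⟩, ?_, ?_⟩
  · exact h.symm.trans (φ.2.trans h)
  · exact h.trans (φ.2.trans h.symm)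
  · intro φ; ext1; simp [mul_assoc]
  · intro φ; ext1; simp [mul_assoc]

theorem ext_label {e n : ℕ} {Γ Γ' : MarkedGraph e n} (h1 : Γ.α = Γ'.α) (h2 : Γ.σ = Γ'.σ)
    (h3 : Γ.label = Γ'.label) : Γ = Γ' := by
  obtain ⟨⟨a, s, _, _, _, _⟩, m⟩ := Γ
  obtain ⟨⟨a', s', _, _, _, _⟩, m'⟩ := Γ'
  obtain rfl : a = a' := h1
  obtain rfl : s = s' := h2
  have : m = m' := by
    ext x
    induction x using Quotient.inductionOn with
    | h x => exact congrArg Fin.val (congrFun h3 x)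
  rw [this]

instance finite (e n : ℕ) : Finite (MarkedGraph e n) :=
  Finite.of_injective (fun Γ : MarkedGraph e n => (Γ.α, Γ.σ, Γ.label)) fun Γ Γ' h => by
    simp only [Prod.mk.injEq] at h
    exact ext_label h.1 h.2.1 h.2.2

theorem sum_degree {e n : ℕ} (Γ : MarkedGraph e n) : ∑ i, Γ.degree i = 2 * e := by
  have := Nat.card_congr (Equiv.sigmaFiberEquiv Γ.label)
  rw [Nat.card_sigma] at this
  simpa [degree] using this

end MarkedGraph

/-- Marked graphs of genus `g` with `n` vertices and `e` edges whose vertex labelled `i` has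
degree `μ i`, not yet identified up to isomorphism. -/
def MarkedGraphOfType (e g : ℕ) {n : ℕ} (μ : Fin n → ℕ) : Type :=
  {Γ : MarkedGraph e n // Γ.HasGenus g ∧ ∀ i, Γ.degree i = μ i}

/-- Two marked graphs are identified if there is a marked isomorphism between them. -/
instance markedIsoSetoid (e g : ℕ) {n : ℕ} (μ : Fin n → ℕ) :
    Setoid (MarkedGraphOfType e g μ) where
  r Γ Γ' := ∃ ψ, MarkedGraph.IsMarkedIso Γ.1 Γ'.1 ψ
  iseqv :=
    { refl := fun Γ => ⟨1, MarkedGraph.IsMarkedIso.refl Γ.1⟩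
      symm := fun ⟨ψ, h⟩ => ⟨ψ⁻¹, h.symm⟩
      trans := fun ⟨ψ, h⟩ ⟨φ, h'⟩ => ⟨φ * ψ, h.trans h'⟩ }

/-- The set `G_{g,n}(μ₁, …, μₙ)` of distinct marked graphs (with any number of edges `e`) of genus
`g` with `n` vertices, the vertex labelled `i` having degree `μ i`. -/
def GraphSet (g : ℕ) {n : ℕ} (μ : Fin n → ℕ) : Type :=
  Σ e : ℕ, Quotient (markedIsoSetoid e g μ)

instance GraphSet.finite (g : ℕ) {n : ℕ} (μ : Fin n → ℕ) : Finite (GraphSet g μ) := by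
  have hfin : ∀ e, Finite (MarkedGraphOfType e g μ) := fun e => by
    unfold MarkedGraphOfType; infer_instance
  have he : ∀ x : GraphSet g μ, x.1 < ∑ i, μ i + 1 := by
    rintro ⟨e, q⟩
    induction q using Quotient.inductionOn with
    | h Γ =>
      have h := Γ.1.sum_degree
      simp only [Γ.2.2] at h
      simp only
      omega
  refine Finite.of_injective
    (β := Σ e : Fin (∑ i, μ i + 1), Quotient (markedIsoSetoid e.1 g μ))
    (fun x => ⟨⟨x.1, he x⟩, x.2⟩) ?_
  rintro ⟨e, q⟩ ⟨e', q'⟩ h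
  simp only [Sigma.mk.injEq, Fin.mk.injEq] at h
  obtain ⟨rfl, h⟩ := h
  rw [eq_of_heq h]

noncomputable instance GraphSet.fintype (g : ℕ) {n : ℕ} (μ : Fin n → ℕ) :
    Fintype (GraphSet g μ) :=
  Fintype.ofFinite _

/-- The order of the group of marked automorphisms, as a function of the isomorphism class. -/
noncomputable def GraphSet.autCard {g n : ℕ} {μ : Fin n → ℕ} (x : GraphSet g μ) : ℕ :=
  Quotient.lift (s := markedIsoSetoid x.1 g μ)
    (fun Γ : MarkedGraphOfType x.1 g μ => Nat.card Γ.1.autV)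
    (fun _ _ ⟨_, h⟩ => MarkedGraph.card_autV_eq h) x.2

/-- `D_{g,n}(μ₁, …, μₙ)`: the number of marked graphs in `G_{g,n}(μ₁, …, μₙ)`, each counted with
weight `1 / |Aut_v|`. -/
noncomputable def numD (g : ℕ) {n : ℕ} (μ : Fin n → ℕ) : ℚ :=
  ∑ x : GraphSet g μ, 1 / (x.autCard : ℚ)

/-- `C_{g,n}(μ₁, …, μₙ) = μ₁ ⋯ μₙ · D_{g,n}(μ₁, …, μₙ)`, for positive degrees `μ i`. -/
noncomputable def numC (g : ℕ) {n : ℕ} (μ : Fin n → ℕ) : ℚ :=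
  (∏ i, (μ i : ℚ)) * numD g μ

/-- `g(μ) = 2^[μ/2] (2[(μ-1)/2] + 1)!! / [(μ-1)/2]!` for a positive integer `μ`. -/
def gFun (μ : ℕ) : ℚ :=
  2 ^ (μ / 2) * ((2 * ((μ - 1) / 2) + 1).doubleFactorial : ℚ) / (((μ - 1) / 2).factorial : ℚ)

/-!
A marked graph whose vertices have degrees `μ`, together with a chosen half-edge at every vertex,
is the same thing as a way of gluing in pairs the half-edges of a fixed collection of standard
vertices (`numC_zero_eq_gluingCount`): a base point on each vertex has no nontrivial automorphism,
so the weights `1 / |Aut|` and the factors `μ i` cancel. Thus the claim is a count of the pairings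
`α`, for a fixed rotation `σ`, that are connected and planar.

These pairings are counted by contracting the edge from a chosen half-edge `h` to `k = α h`, that
is, by multiplying both `σ` and `α` by the transposition of `h` and `k`. The permutation `σ⁻¹ α`,
and with it the faces, does not change. The points `h` and `k` are kept in `H` as points without an
edge, so that a vertex all of whose edges are gone is still a cycle of `σ`; the remaining half-edges
form the set `S`. If `h` and `k` lie on different vertices, these merge. If the edge is a loop, its
vertex is cut in two, and Euler's inequality (`euler_inequality`) shows that the gluing was planar
exactly if the two parts then lie in different components, each of them planar
(`card_gluing_of_sameCycle`, `isSplitGluing_iff`). This gives a recursion in the degrees which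
determines the numbers (`PlanarRecursion`, `gluingCount_eq`).

For one, two and three vertices the recursion is solved by `disc` (the Catalan numbers), `annulus`
and `pants`. Their convolution identities `disc_rec`, `annulus_rec` and `pants_rec` are proved with
generating functions: `√(1 - 4X²)` equals `1 - 2X² U`, where `U` is the series of `disc`, its
inverse is the series of the central binomial coefficients, and the series of `annulus · b` is the
product of that inverse with a shifted Catalan series (`mk_annulus`). A partial fraction
decomposition reduces the product of two `annulus` terms in `pants_rec` to a convolution that has a
closed form (`annulusConv_closed`).
-/

/-! ### The closed formulas and the convolution identities they satisfy -/

namespace PlanarCount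

open PowerSeries

/-- The number of planar gluings of a disc with `a` marked boundary points: a Catalan number for
even `a`, and zero for odd `a`. -/
def disc (a : ℕ) : ℚ := if Even a then (catalan (a / 2) : ℚ) else 0

/-- The central binomial coefficients `binom (2k) k`, placed in the even degrees `2k`. -/
def evenBinom (a : ℕ) : ℚ := if Even a then (Nat.centralBinom (a / 2) : ℚ) else 0

/-- The factor contributed by a vertex with `a` half-edges. For `a ≥ 1` it is `gFun a`, but it
vanishes at `a = 0`, as the recursion requires. -/
def weight (a : ℕ) : ℚ := (a : ℚ) * ((a - 1).choose (a / 2) : ℚ)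

/-- The number of connected planar gluings with two vertices of degrees `a` and `b`. -/
def annulus (a b : ℕ) : ℚ :=
  if Even (a + b) then 2 * weight a * weight b / ((a : ℚ) + b) else 0

/-- The number of connected planar gluings with three vertices of degrees `a`, `b`, `c`. -/
def pants (a b c : ℕ) : ℚ :=
  if Even (a + b + c) then weight a * weight b * weight c else 0

theorem disc_even (k : ℕ) : disc (2 * k) = catalan k := by simp [disc]

theorem disc_odd (k : ℕ) : disc (2 * k + 1) = 0 := by simp [disc]

theorem evenBinom_even (k : ℕ) : evenBinom (2 * k) = Nat.centralBinom k := by simp [evenBinom]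

theorem evenBinom_odd (k : ℕ) : evenBinom (2 * k + 1) = 0 := by simp [evenBinom]

theorem weight_odd (k : ℕ) : weight (2 * k + 1) = (2 * k + 1) * Nat.centralBinom k := by
  have h : (2 * k + 1) / 2 = k := by omega
  simp [weight, h, Nat.centralBinom]

theorem weight_even (k : ℕ) : weight (2 * k) = k * Nat.centralBinom k := by
  cases k with
  | zero => simp [weight]
  | succ k =>
    have h : 2 * (k + 1) / 2 = k + 1 := by omega
    have h2 : Nat.centralBinom (k + 1) = 2 * (2 * k + 1).choose (k + 1) := by
      rw [Nat.centralBinom, show 2 * (k + 1) = (2 * k + 1) + 1 by ring, Nat.choose_succ_succ,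
        Nat.choose_symm_half]
      ring
    rw [weight, h, h2, show 2 * (k + 1) - 1 = 2 * k + 1 by omega]
    push_cast
    ring

theorem weight_zero : weight 0 = 0 := by simp [weight]

theorem centralBinom_succ_cast (k : ℕ) :
    ((k : ℚ) + 1) * Nat.centralBinom (k + 1) = 2 * (2 * k + 1) * Nat.centralBinom k := by
  exact_mod_cast Nat.succ_mul_centralBinom_succ k

theorem catalan_cast (k : ℕ) : (catalan k : ℚ) = Nat.centralBinom k / (k + 1) := by
  have h : ((k : ℚ) + 1) * catalan k = Nat.centralBinom k := by
    exact_mod_cast succ_mul_catalan_eq_centralBinom k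
  have : (k : ℚ) + 1 ≠ 0 := by positivity
  field_simp
  linarith

theorem centralBinom_succ_div (k : ℕ) :
    (Nat.centralBinom (k + 1) : ℚ) = 2 * (2 * k + 1) * Nat.centralBinom k / (k + 1) := by
  have h := centralBinom_succ_cast k
  have : (k : ℚ) + 1 ≠ 0 := by positivity
  field_simp
  linarith

theorem weight_succ (a : ℕ) : weight (a + 1) = 2 * weight a + evenBinom a := by
  obtain ⟨k, rfl | rfl⟩ := Nat.even_or_odd' a
  · rw [weight_odd, weight_even, evenBinom_even]; ring
  · rw [weight_odd, show 2 * k + 1 + 1 = 2 * (k + 1) by ring, weight_even, evenBinom_odd]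
    push_cast
    rw [centralBinom_succ_cast]; ring

theorem annulus_zero_right (a : ℕ) : annulus a 0 = 0 := by simp [annulus, weight_zero]

theorem annulus_eq_zero {a b : ℕ} (h : ¬ Even (a + b)) : annulus a b = 0 := if_neg h

theorem disc_eq_zero {a : ℕ} (h : ¬ Even a) : disc a = 0 := if_neg h

/-- The step of the telescoping sum `sum_evenBinom_mul_disc`. -/
theorem annulus_succ_div (a b : ℕ) :
    annulus (a + 1) (b + 1) / (b + 1) =
      annulus a (b + 2) / (b + 2) + evenBinom a * disc b := by
  have hpos : ∀ m n : ℕ, ((m : ℚ) + n + 1) ≠ 0 := fun m n => by positivity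
  obtain ⟨k, rfl | rfl⟩ := Nat.even_or_odd' a <;> obtain ⟨l, rfl | rfl⟩ := Nat.even_or_odd' b
  · have e1 : Even (2 * k + 1 + (2 * l + 1)) := ⟨k + l + 1, by ring⟩
    have e2 : Even (2 * k + (2 * l + 2)) := ⟨k + l + 1, by ring⟩
    rw [annulus, if_pos e1, annulus, if_pos e2, evenBinom_even, disc_even, weight_odd, weight_odd,
      show 2 * l + 2 = 2 * (l + 1) by ring, weight_even, weight_even, catalan_cast,
      centralBinom_succ_div]
    push_cast
    have h1 := hpos k l
    have h2 : (l : ℚ) + 1 ≠ 0 := by positivity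
    have h3 : (2 * k + 1 : ℚ) + (2 * l + 1) ≠ 0 := by positivity
    have h4 : (2 * k : ℚ) + 2 * (l + 1) ≠ 0 := by positivity
    have h5 : (2 * l : ℚ) + 1 ≠ 0 := by positivity
    have h6 : (2 * l : ℚ) + 2 ≠ 0 := by positivity
    field_simp
    ring
  · have e1 : ¬ Even (2 * k + 1 + (2 * l + 1 + 1)) := by
      rw [Nat.not_even_iff_odd]; exact ⟨k + l + 1, by ring⟩
    have e2 : ¬ Even (2 * k + (2 * l + 1 + 2)) := by
      rw [Nat.not_even_iff_odd]; exact ⟨k + l + 1, by ring⟩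
    rw [annulus_eq_zero e1, annulus_eq_zero e2, disc_odd]; simp
  · have e1 : ¬ Even (2 * k + 1 + 1 + (2 * l + 1)) := by
      rw [Nat.not_even_iff_odd]; exact ⟨k + l + 1, by ring⟩
    have e2 : ¬ Even (2 * k + 1 + (2 * l + 2)) := by
      rw [Nat.not_even_iff_odd]; exact ⟨k + l + 1, by ring⟩
    rw [annulus_eq_zero e1, annulus_eq_zero e2, evenBinom_odd]; simp
  · have e1 : Even (2 * k + 1 + 1 + (2 * l + 1 + 1)) := ⟨k + l + 2, by ring⟩
    have e2 : Even (2 * k + 1 + (2 * l + 1 + 2)) := ⟨k + l + 2, by ring⟩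
    rw [annulus, if_pos e1, annulus, if_pos e2, evenBinom_odd,
      show 2 * l + 1 + 2 = 2 * (l + 1) + 1 by ring, weight_odd, weight_odd,
      show 2 * l + 1 + 1 = 2 * (l + 1) by ring, show 2 * k + 1 + 1 = 2 * (k + 1) by ring,
      weight_even, weight_even, centralBinom_succ_div k]
    push_cast
    have h2 : (l : ℚ) + 1 ≠ 0 := by positivity
    have h2' : (k : ℚ) + 1 ≠ 0 := by positivity
    have h3 : (2 * k + 1 : ℚ) + (2 * (l + 1) + 1) ≠ 0 := by positivity
    have h4 : (2 * (k + 1) : ℚ) + 2 * (l + 1) ≠ 0 := by positivity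
    have h5 : (2 * l : ℚ) + 1 + 1 ≠ 0 := by positivity
    have h6 : (2 * l : ℚ) + 1 + 2 ≠ 0 := by positivity
    field_simp
    ring

/-- A partial convolution of Catalan numbers and central binomial coefficients. -/
theorem sum_evenBinom_mul_disc (a b : ℕ) :
    ((b : ℚ) + 1) * ∑ i ∈ Finset.range a, evenBinom i * disc (a - i + (b + 1) - 2) =
      annulus a (b + 1) := by
  induction a generalizing b with
  | zero => simp [annulus, weight_zero]
  | succ a ih =>
    rw [Finset.sum_range_succ]
    have h1 : ∑ i ∈ Finset.range a, evenBinom i * disc (a + 1 - i + (b + 1) - 2) =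
        ∑ i ∈ Finset.range a, evenBinom i * disc (a - i + (b + 1 + 1) - 2) := by
      refine Finset.sum_congr rfl fun i hi => ?_
      have := Finset.mem_range.1 hi
      congr 2
      omega
    have h2 := ih (b + 1)
    have h3 := annulus_succ_div a b
    have hb : (b : ℚ) + 1 ≠ 0 := by positivity
    have hb' : (b : ℚ) + 2 ≠ 0 := by positivity
    rw [h1, show a + 1 - a + (b + 1) - 2 = b by omega]
    push_cast at h2
    rw [show (b : ℚ) + 1 + 1 = b + 2 by ring] at h2
    rw [← h2, mul_div_cancel_left₀ _ hb'] at h3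
    rw [← h3]
    field_simp

theorem coeff_X_sq_mul_mk_mul_mk (f g : ℕ → ℚ) (a : ℕ) :
    coeff a (X ^ 2 * (mk f * mk g)) = ∑ i ∈ Finset.range (a - 1), f i * g (a - 2 - i) := by
  rw [coeff_X_pow_mul']
  split_ifs with h
  · rw [coeff_mul, Finset.Nat.sum_antidiagonal_eq_sum_range_succ
      (fun i j => coeff i (mk f) * coeff j (mk g))]
    simp only [coeff_mk]
    congr 2
    omega
  · rw [show a - 1 = 0 by omega]; simp

/-- The square root `√(1 - 4X²)`, written through the generating function of `disc`. -/
noncomputable def sqrtSeries : PowerSeries ℚ := 1 - 2 * X ^ 2 * mk disc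

/-- The generating function, in `a`, of the first term of the recursion for `annulus a b`. -/
noncomputable def mergeSeries (b : ℕ) : PowerSeries ℚ :=
  mk fun a => if a = 0 then 0 else (b : ℚ) * disc (a + b - 2)

theorem disc_rec {a : ℕ} (ha : 1 ≤ a) :
    disc a = ∑ i ∈ Finset.range (a - 1), disc i * disc (a - 2 - i) := by
  obtain ⟨k, rfl | rfl⟩ := Nat.even_or_odd' a
  · obtain ⟨k, rfl⟩ : ∃ l, k = l + 1 := ⟨k - 1, by omega⟩
    have hs : ∀ n : ℕ, ∑ i ∈ Finset.range (2 * n + 1), disc i * disc (2 * k - i) =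
        ∑ i ∈ Finset.range (n + 1), disc (2 * i) * disc (2 * k - 2 * i) := by
      intro n
      induction n with
      | zero => simp
      | succ n ih =>
        rw [show 2 * (n + 1) + 1 = 2 * n + 1 + 1 + 1 by ring, Finset.sum_range_succ,
          Finset.sum_range_succ, ih, disc_odd, Finset.sum_range_succ _ (n + 1)]
        ring_nf
    rw [show 2 * (k + 1) - 1 = 2 * k + 1 by omega, show 2 * (k + 1) - 2 = 2 * k by omega, hs,
      disc_even, catalan_succ, Fin.sum_univ_eq_sum_range (fun i => catalan i * catalan (k - i))]
    push_cast
    refine Finset.sum_congr rfl fun i _ => ?_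
    rw [show 2 * k - 2 * i = 2 * (k - i) by omega, disc_even, disc_even]
  · rw [disc_odd, Finset.sum_eq_zero]
    intro i hi
    have := Finset.mem_range.1 hi
    obtain ⟨j, rfl | rfl⟩ := Nat.even_or_odd' i
    · rw [show 2 * k + 1 - 2 - 2 * j = 2 * (k - 1 - j) + 1 by omega, disc_odd, mul_zero]
    · rw [disc_odd, zero_mul]

theorem disc_zero : disc 0 = 1 := by simp [disc]

theorem mk_disc_eq : mk disc = 1 + X ^ 2 * (mk disc * mk disc) := by
  ext a
  rw [map_add, coeff_X_sq_mul_mk_mul_mk, coeff_mk, coeff_one]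
  rcases Nat.eq_zero_or_pos a with rfl | ha
  · simp [disc_zero]
  · rw [← disc_rec ha, if_neg (by omega), zero_add]

theorem sqrtSeries_sq : sqrtSeries * sqrtSeries = 1 - 4 * X ^ 2 := by
  have h := mk_disc_eq
  rw [sqrtSeries]
  linear_combination (-4 * X ^ 2) * h

/-- The telescoping sum `sum_evenBinom_mul_disc` as an identity of generating functions. -/
theorem mk_annulus (b : ℕ) : mk (fun a => annulus a b) = mk evenBinom * mergeSeries b := by
  ext a
  rw [coeff_mk, mergeSeries, coeff_mul, Finset.Nat.sum_antidiagonal_eq_sum_range_succ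
      (fun i j => coeff i (mk evenBinom) *
        coeff j (mk fun a => if a = 0 then 0 else (b : ℚ) * disc (a + b - 2)))]
  simp only [coeff_mk]
  rw [Finset.sum_range_succ]
  simp only [Nat.sub_self, if_true, mul_zero, add_zero]
  cases b with
  | zero => simp [annulus_zero_right]
  | succ b =>
    rw [← sum_evenBinom_mul_disc, Finset.mul_sum]
    refine Finset.sum_congr rfl fun i hi => ?_
    have := Finset.mem_range.1 hi
    rw [if_neg (by omega)]
    push_cast
    ring

theorem evenBinom_mul_sqrtSeries : mk evenBinom * sqrtSeries = 1 := by
  rw [sqrtSeries]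
  have h : mk evenBinom = 1 + X ^ 2 * (2 * (mk evenBinom * mk disc)) := by
    ext a
    rw [show (X ^ 2 * (2 * (mk evenBinom * mk disc)) : PowerSeries ℚ) =
      C (2 : ℚ) * (X ^ 2 * (mk evenBinom * mk disc)) by rw [map_ofNat]; ring, map_add, coeff_C_mul,
      coeff_X_sq_mul_mk_mul_mk, coeff_mk, coeff_one]
    rcases Nat.eq_zero_or_pos a with rfl | ha
    · simp [evenBinom]
    · rw [if_neg (by omega), zero_add]
      obtain ⟨a, rfl⟩ : ∃ l, a = l + 1 := ⟨a - 1, by omega⟩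
      have h1 := sum_evenBinom_mul_disc a 0
      have h2 : ∑ i ∈ Finset.range (a + 1 - 1), evenBinom i * disc (a + 1 - 2 - i) =
          ∑ i ∈ Finset.range a, evenBinom i * disc (a - i + (0 + 1) - 2) := by
        refine Finset.sum_congr rfl fun i hi => ?_
        have := Finset.mem_range.1 hi
        congr 2
        omega
      rw [h2]
      simp only [CharP.cast_eq_zero, zero_add, one_mul] at h1
      rw [h1]
      obtain ⟨k, rfl | rfl⟩ := Nat.even_or_odd' a
      · rw [evenBinom_odd, annulus_eq_zero, mul_zero]
        rw [Nat.not_even_iff_odd]; exact ⟨k, by ring⟩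
      · have e1 : Even (2 * k + 1 + 1) := ⟨k + 1, by ring⟩
        rw [annulus, if_pos e1, show 2 * k + 1 + 1 = 2 * (k + 1) by ring, evenBinom_even,
          weight_odd, centralBinom_succ_div]
        simp only [weight, Nat.cast_one, Nat.sub_self, Nat.reduceDiv, Nat.choose_zero_right]
        push_cast
        have h3 : (2 * k + 1 : ℚ) + 1 ≠ 0 := by positivity
        have h2' : (k : ℚ) + 1 ≠ 0 := by positivity
        field_simp
        ring
  linear_combination h

theorem annulus_rec {a : ℕ} (ha : 1 ≤ a) (b : ℕ) :
    annulus a b = (b : ℚ) * disc (a + b - 2) +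
      2 * ∑ i ∈ Finset.range (a - 1), disc i * annulus (a - 2 - i) b := by
  have h : mk (fun a => annulus a b) = mergeSeries b +
      C (2 : ℚ) * (X ^ 2 * (mk disc * mk fun a => annulus a b)) := by
    have h1 : mk (fun a => annulus a b) * sqrtSeries = mergeSeries b := by
      rw [mk_annulus]; linear_combination mergeSeries b * evenBinom_mul_sqrtSeries
    rw [sqrtSeries] at h1
    rw [map_ofNat]
    linear_combination h1
  have := congrArg (coeff a) h
  rw [map_add, coeff_C_mul, coeff_X_sq_mul_mk_mul_mk, coeff_mk, mergeSeries, coeff_mk,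
    if_neg (by omega)] at this
  exact this

theorem mk_weight_mul : mk weight * (1 - 2 * X) = X * mk evenBinom := by
  have h : mk weight = C (2 : ℚ) * (X * mk weight) + X * mk evenBinom := by
    ext a
    rw [map_add, coeff_C_mul]
    cases a with
    | zero => simp [weight_zero]
    | succ a => rw [coeff_succ_X_mul, coeff_succ_X_mul, coeff_mk, coeff_mk, coeff_mk, weight_succ]
  rw [map_ofNat] at h
  linear_combination h

/-- Multiplying the generating function of `weight` by `√(1 - 4X²)` gives `X / (1 - 2X)`, whence
the powers of two. -/
theorem weight_rec {a : ℕ} (ha : 1 ≤ a) :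
    weight a = 2 * ∑ i ∈ Finset.range (a - 1), disc i * weight (a - 2 - i) + 2 ^ (a - 1) := by
  set E : PowerSeries ℚ := mk weight * sqrtSeries with hE
  have h1 : E = C (2 : ℚ) * (X * E) + X := by
    rw [map_ofNat]
    linear_combination sqrtSeries * mk_weight_mul + X * evenBinom_mul_sqrtSeries
  have h2 : ∀ n, coeff (n + 1) E = 2 ^ n := by
    intro n
    induction n with
    | zero =>
      rw [h1, map_add, coeff_C_mul, coeff_succ_X_mul, hE]
      simp [weight_zero]
    | succ n ih =>
      rw [h1, map_add, coeff_C_mul, coeff_succ_X_mul, ih, coeff_X, if_neg (by omega)]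
      ring
  have h3 : mk weight = C (2 : ℚ) * (X ^ 2 * (mk disc * mk weight)) + E := by
    rw [map_ofNat, hE, sqrtSeries]; ring
  have := congrArg (coeff a) h3
  rw [map_add, coeff_C_mul, coeff_X_sq_mul_mk_mul_mk, coeff_mk] at this
  rw [this]
  obtain ⟨a, rfl⟩ : ∃ l, a = l + 1 := ⟨a - 1, by omega⟩
  rw [h2]
  rfl

theorem evenBinom_add_two (m : ℕ) : evenBinom (m + 2) - 4 * evenBinom m = -2 * disc m := by
  obtain ⟨k, rfl | rfl⟩ := Nat.even_or_odd' m
  · rw [show 2 * k + 2 = 2 * (k + 1) by ring, evenBinom_even, evenBinom_even, disc_even,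
      centralBinom_succ_div, catalan_cast]
    have h2' : (k : ℚ) + 1 ≠ 0 := by positivity
    field_simp
    ring
  · rw [show 2 * k + 1 + 2 = 2 * (k + 1) + 1 by ring, evenBinom_odd, evenBinom_odd, disc_odd]
    simp

/-- The convolution of `annulus · b` with `weight`, in degree `a`. -/
def annulusConv (a b : ℕ) : ℚ :=
  ∑ i ∈ Finset.range (a - 1), annulus i b * weight (a - 2 - i)

/-- The coefficients of `(1 - 2X)(1 - 4X²) Y = X³ M`, where `Y` generates `annulusConv · b` and `M`
is `mergeSeries b`. -/
theorem annulusConv_rec (a b : ℕ) :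
    annulusConv (a + 4) b = 2 * annulusConv (a + 3) b + 4 * annulusConv (a + 2) b
      - 8 * annulusConv (a + 1) b + (b : ℚ) * disc (a + 1 + b - 2) := by
  set Y : PowerSeries ℚ := X ^ 2 * (mk (fun a => annulus a b) * mk weight) with hY
  have hc : ∀ n, coeff n Y = annulusConv n b := fun n => by
    rw [hY, coeff_X_sq_mul_mk_mul_mk, annulusConv]
  have h : Y = C (2 : ℚ) * (X ^ 1 * Y) + C (4 : ℚ) * (X ^ 2 * Y) - C (8 : ℚ) * (X ^ 3 * Y)
      + X ^ 3 * mergeSeries b := by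
    simp only [map_ofNat]
    rw [hY, mk_annulus]
    have h1 := mk_weight_mul
    have h2 := evenBinom_mul_sqrtSeries
    have h3 := sqrtSeries_sq
    have h4 : mk evenBinom * mk evenBinom * (1 - 4 * X ^ 2) = 1 := by
      rw [← h3]; linear_combination (mk evenBinom * sqrtSeries + 1) * h2
    linear_combination X ^ 2 * mk evenBinom * mergeSeries b * (1 - 4 * X ^ 2) * h1 +
      X ^ 3 * mergeSeries b * h4
  have := congrArg (coeff (a + 4)) h
  simp only [map_add, map_sub, coeff_C_mul, coeff_X_pow_mul', hc] at this
  rw [this, if_pos (by omega), if_pos (by omega), if_pos (by omega), if_pos (by omega),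
    mergeSeries, coeff_mk, if_neg (by omega)]
  rfl

/-- The sign on the right depends on the parity of `b`; it cancels in `pants_rec`, where it occurs
for two degrees of opposite parity. -/
theorem annulusConv_closed (a b : ℕ) :
    4 * ((b + 1 : ℚ) * weight (a + b)) + 8 * annulusConv (a + 1) (b + 1) =
      weight (b + 1) * 2 ^ a * (2 * (b + 1) + a - 1 + if Even a then (-1) ^ (b + 1) else 0) := by
  have h0 : 4 * (b + 1 : ℚ) * weight b = weight (b + 1) * (2 * (b + 1) - 1 + (-1) ^ (b + 1)) := by
    obtain ⟨k, rfl | rfl⟩ := Nat.even_or_odd' b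
    · rw [weight_even, weight_odd, Odd.neg_one_pow ⟨k, rfl⟩]
      push_cast; ring
    · rw [weight_odd, show 2 * k + 1 + 1 = 2 * (k + 1) by ring, weight_even,
        Even.neg_one_pow ⟨k + 1, by ring⟩, centralBinom_succ_div]
      have h2' : (k : ℚ) + 1 ≠ 0 := by positivity
      push_cast; field_simp; ring
  have h1 : evenBinom b * (b + 1) * 2 = weight (b + 1) * (1 - (-1) ^ (b + 1)) := by
    obtain ⟨k, rfl | rfl⟩ := Nat.even_or_odd' b
    · rw [evenBinom_even, weight_odd, Odd.neg_one_pow ⟨k, rfl⟩]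
      push_cast; ring
    · rw [evenBinom_odd, Even.neg_one_pow ⟨k + 1, by ring⟩]
      ring
  induction a using Nat.strong_induction_on with
  | _ a ih =>
    match a with
    | 0 => simp [annulusConv] at *; linarith
    | 1 =>
      simp [annulusConv, add_comm 1 b, annulus, weight_zero]
      ring
    | 2 =>
      have e : annulusConv (2 + 1) (b + 1) = 0 := by
        simp [annulusConv, Finset.sum_range_succ, weight_zero, annulus]
      rw [e, show 2 + b = b + 1 + 1 by ring, weight_succ (b + 1)]
      have h2 : evenBinom (b + 1) * (b + 1) = weight (b + 1) * (1 + (-1) ^ (b + 1)) := by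
        obtain ⟨k, rfl | rfl⟩ := Nat.even_or_odd' b
        · rw [evenBinom_odd, Odd.neg_one_pow ⟨k, rfl⟩]
          push_cast; ring
        · rw [show 2 * k + 1 + 1 = 2 * (k + 1) by ring, evenBinom_even, weight_even,
            Even.neg_one_pow ⟨k + 1, by ring⟩]
          push_cast; ring
      rw [if_pos even_two]
      push_cast
      linarith
    | a + 3 =>
      have i0 := ih a (by omega)
      have i1 := ih (a + 1) (by omega)
      have i2 := ih (a + 2) (by omega)
      have r := annulusConv_rec a (b + 1)
      have w0 := weight_succ (a + b)
      have w1 := weight_succ (a + b + 1)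
      have w2 := weight_succ (a + b + 2)
      have e := evenBinom_add_two (a + b)
      rw [show a + 1 + (b + 1) - 2 = a + b by omega] at r
      rw [show a + 3 + 1 = a + 4 by ring, r]
      rw [show a + 2 + 1 = a + 3 by ring, show a + 2 + b = a + b + 2 by ring] at i2
      rw [show a + 1 + 1 = a + 2 by ring, show a + 1 + b = a + b + 1 by ring] at i1
      rw [show a + 3 + b = a + b + 2 + 1 by ring, w2]
      rw [show a + b + 1 + 1 = a + b + 2 by ring] at w1
      rcases Nat.even_or_odd a with ha | ha
      · have n1 : ¬ Even (a + 1) := by simpa [Nat.even_add_one] using ha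
        have n2 : Even (a + 2) := by simpa [Nat.even_add] using ha
        have n3 : ¬ Even (a + 3) := by simpa [Nat.even_add_one] using ha
        rw [if_pos ha] at i0
        rw [if_neg n1] at i1
        rw [if_pos n2] at i2
        rw [if_neg n3]
        push_cast at *
        linear_combination 2 * i2 + 4 * i1 - 8 * i0 + 4 * (b + 1 : ℚ) * e -
          16 * (b + 1 : ℚ) * w0
      · have n0 : ¬ Even a := by simpa using ha
        have n1 : Even (a + 1) := by simpa [Nat.even_add_one] using ha
        have n2 : ¬ Even (a + 2) := by simpa [Nat.even_add_one] using ha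
        have n3 : Even (a + 3) := by simpa [Nat.even_add_one] using ha
        rw [if_neg n0] at i0
        rw [if_pos n1] at i1
        rw [if_neg n2] at i2
        rw [if_pos n3]
        push_cast at *
        linear_combination 2 * i2 + 4 * i1 - 8 * i0 + 4 * (b + 1 : ℚ) * e -
          16 * (b + 1 : ℚ) * w0

theorem sum_disc_mul_pants {a b c : ℕ} (h : Even (a + b + c)) :
    ∑ i ∈ Finset.range (a - 1), disc i * pants (a - 2 - i) b c =
      (∑ i ∈ Finset.range (a - 1), disc i * weight (a - 2 - i)) * (weight b * weight c) := by
  rw [Finset.sum_mul]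
  refine Finset.sum_congr rfl fun i hi => ?_
  have := Finset.mem_range.1 hi
  by_cases hi' : Even i
  · have : Even (a - 2 - i + b + c) := by grind
    rw [pants, if_pos this]; ring
  · rw [disc_eq_zero hi']; ring

/-- Partial fractions in the denominators `i + b` and `a - 2 - i + c`, whose sum does not depend
on `i`. -/
theorem sum_annulus_mul_annulus {a b c : ℕ} (hb : 1 ≤ b) (hc : 1 ≤ c)
    (h : Even (a + b + c)) :
    ((a : ℚ) + b + c - 2) *
        ∑ i ∈ Finset.range (a - 1), annulus i b * annulus (a - 2 - i) c =
      2 * (weight c * annulusConv a b + weight b * annulusConv a c) := by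
  have hr : annulusConv a c =
      ∑ i ∈ Finset.range (a - 1), annulus (a - 2 - i) c * weight i := by
    rw [annulusConv, ← Finset.sum_range_reflect]
    refine Finset.sum_congr rfl fun i hi => ?_
    have := Finset.mem_range.1 hi
    rw [show a - 1 - 1 - i = a - 2 - i by omega, show a - 2 - (a - 2 - i) = i by omega]
  rw [hr, annulusConv, Finset.mul_sum, Finset.mul_sum, Finset.mul_sum, ← Finset.sum_add_distrib,
    Finset.mul_sum]
  refine Finset.sum_congr rfl fun i hi => ?_
  have hi' := Finset.mem_range.1 hi
  by_cases e : Even (i + b)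
  · have e' : Even (a - 2 - i + c) := by grind
    rw [annulus, if_pos e, annulus, if_pos e']
    obtain ⟨j, rfl⟩ : ∃ j, a = i + j + 2 := ⟨a - 2 - i, by omega⟩
    rw [show i + j + 2 - 2 - i = j by omega]
    have h1 : (i : ℚ) + b ≠ 0 := by exact_mod_cast (by omega : i + b ≠ 0)
    have h2 : (j : ℚ) + c ≠ 0 := by exact_mod_cast (by omega : j + c ≠ 0)
    push_cast
    field_simp
    ring
  · have e' : ¬ Even (a - 2 - i + c) := by grind
    rw [annulus_eq_zero e, annulus_eq_zero e']
    ring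

theorem pants_rec {a : ℕ} (ha : 1 ≤ a) (b c : ℕ) :
    pants a b c = (b : ℚ) * annulus (a + b - 2) c + (c : ℚ) * annulus (a + c - 2) b +
      2 * ∑ i ∈ Finset.range (a - 1),
        (disc i * pants (a - 2 - i) b c + annulus i b * annulus (a - 2 - i) c) := by
  rcases Nat.eq_zero_or_pos b with rfl | hb
  · simp [pants, annulus, weight_zero]
  rcases Nat.eq_zero_or_pos c with rfl | hc
  · simp [pants, annulus, weight_zero]
  by_cases h : Even (a + b + c)
  · rw [Finset.sum_add_distrib, sum_disc_mul_pants h]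
    have hS := sum_annulus_mul_annulus hb hc h
    have hW := weight_rec ha
    obtain ⟨a, rfl⟩ : ∃ l, a = l + 1 := ⟨a - 1, by omega⟩
    obtain ⟨b, rfl⟩ : ∃ l, b = l + 1 := ⟨b - 1, by omega⟩
    obtain ⟨c, rfl⟩ : ∃ l, c = l + 1 := ⟨c - 1, by omega⟩
    have cb := annulusConv_closed a b
    have cc := annulusConv_closed a c
    have e1 : Even (a + b + (c + 1)) := by grind
    have e2 : Even (a + c + (b + 1)) := by grind
    rw [pants, if_pos h, show a + 1 + (b + 1) - 2 = a + b by omega,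
      show a + 1 + (c + 1) - 2 = a + c by omega, annulus, if_pos e1, annulus, if_pos e2]
    rw [show a + 1 - 1 = a by omega] at *
    have hsign : (if Even a then (-1 : ℚ) ^ (b + 1) else 0) +
        (if Even a then (-1 : ℚ) ^ (c + 1) else 0) = 0 := by
      split_ifs with h'
      · rcases Nat.even_or_odd b with hb' | hb'
        · have : Odd c := by grind
          rw [hb'.add_one.neg_one_pow, this.add_one.neg_one_pow]; ring
        · have : Even c := by grind
          rw [hb'.add_one.neg_one_pow, this.add_one.neg_one_pow]; ring
      · ring
    have hn : (a : ℚ) + b + c + 1 ≠ 0 := by positivity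
    have hn1 : (a : ℚ) + b + (c + 1) ≠ 0 := by positivity
    have hn2 : (a : ℚ) + c + (b + 1) ≠ 0 := by positivity
    push_cast at *
    set S := ∑ i ∈ Finset.range a, annulus i (b + 1) * annulus (a - 1 - i) (c + 1)
    set W := ∑ i ∈ Finset.range a, disc i * weight (a - 1 - i)
    have hS' : S = 2 * (weight (c + 1) * annulusConv (a + 1) (b + 1) +
        weight (b + 1) * annulusConv (a + 1) (c + 1)) / (a + b + c + 1) := by
      rw [eq_div_iff hn]; linear_combination hS
    rw [hS', hW]
    rw [show (a : ℚ) + b + (c + 1) = a + b + c + 1 by ring,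
      show (a : ℚ) + c + (b + 1) = a + b + c + 1 by ring]
    field_simp
    linear_combination -(1 / 2) * weight (c + 1) * cb - (1 / 2) * weight (b + 1) * cc -
      (1 / 2) * weight (b + 1) * weight (c + 1) * 2 ^ a * hsign
  · rw [pants, if_neg h, annulus_eq_zero, annulus_eq_zero, Finset.sum_eq_zero]
    · ring
    · intro i hi
      have hi' := Finset.mem_range.1 hi
      have e1 : disc i * pants (a - 2 - i) b c = 0 := by
        by_cases e : Even i
        · rw [pants, if_neg (by grind), mul_zero]
        · rw [disc_eq_zero e, zero_mul]
      have e2 : annulus i b * annulus (a - 2 - i) c = 0 := by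
        by_cases e : Even (i + b)
        · rw [annulus_eq_zero (a := a - 2 - i) (by grind), mul_zero]
        · rw [annulus_eq_zero e, zero_mul]
      rw [e1, e2, add_zero]
    · grind
    · grind

end PlanarCount

/-! ### Cycles of a permutation multiplied by a transposition -/

namespace PlanarCount

open Equiv Equiv.Perm

variable {H : Type}

/-- The equivalence relation obtained from `r` by merging the classes of `h` and `k`. -/
def joinPair (r : Setoid H) (h k : H) : Setoid H where
  r x y := r x y ∨ (r x h ∧ r k y) ∨ (r x k ∧ r h y)
  iseqv :=
    { refl := fun x => Or.inl (r.refl x)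
      symm := by
        rintro x y (h1 | ⟨h1, h2⟩ | ⟨h1, h2⟩)
        · exact Or.inl (r.symm h1)
        · exact Or.inr (Or.inr ⟨r.symm h2, r.symm h1⟩)
        · exact Or.inr (Or.inl ⟨r.symm h2, r.symm h1⟩)
      trans := by
        rintro x y z (h1 | ⟨h1, h2⟩ | ⟨h1, h2⟩) (h3 | ⟨h3, h4⟩ | ⟨h3, h4⟩)
        · exact Or.inl (r.trans h1 h3)
        · exact Or.inr (Or.inl ⟨r.trans h1 h3, h4⟩)
        · exact Or.inr (Or.inr ⟨r.trans h1 h3, h4⟩)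
        · exact Or.inr (Or.inl ⟨h1, r.trans h2 h3⟩)
        · exact Or.inr (Or.inl ⟨h1, h4⟩)
        · exact Or.inl (r.trans h1 h4)
        · exact Or.inr (Or.inr ⟨h1, r.trans h2 h3⟩)
        · exact Or.inl (r.trans h1 h4)
        · exact Or.inr (Or.inr ⟨h1, h4⟩) }

theorem le_joinPair (r : Setoid H) (h k : H) : r ≤ joinPair r h k := fun _ _ => Or.inl

theorem joinPair_self (r : Setoid H) (h k : H) : joinPair r h k h k :=
  Or.inr (Or.inl ⟨r.refl h, r.refl k⟩)

theorem joinPair_le_iff {r t : Setoid H} {h k : H} : joinPair r h k ≤ t ↔ r ≤ t ∧ t h k := by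
  refine ⟨fun hle => ⟨(le_joinPair r h k).trans hle, hle (joinPair_self r h k)⟩, ?_⟩
  rintro ⟨h1, h2⟩ x y (h3 | ⟨h3, h4⟩ | ⟨h3, h4⟩)
  · exact h1 h3
  · exact t.trans (h1 h3) (t.trans h2 (h1 h4))
  · exact t.trans (h1 h3) (t.trans (t.symm h2) (h1 h4))

theorem joinPair_eq_self {r : Setoid H} {h k : H} (hr : r h k) : joinPair r h k = r :=
  le_antisymm (joinPair_le_iff.2 ⟨le_rfl, hr⟩) (le_joinPair r h k)

theorem card_quotient_joinPair [Finite H] {r : Setoid H} {h k : H} (hr : ¬ r h k) :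
    Nat.card (Quotient r) = Nat.card (Quotient (joinPair r h k)) + 1 := by
  classical
  let f : {q : Quotient r // q ≠ Quotient.mk r k} → Quotient (joinPair r h k) := fun q =>
    Quotient.map' (s₁ := r) (s₂ := joinPair r h k) id (fun _ _ hxy => Or.inl hxy) q.1
  have hf : Function.Bijective f := by
    constructor
    · rintro ⟨⟨x⟩, hx⟩ ⟨⟨y⟩, hy⟩ hxy
      have hx' : ¬ r x k := fun hh => hx (Quotient.sound hh)
      have hy' : ¬ r y k := fun hh => hy (Quotient.sound hh)
      have hxy' : joinPair r h k x y := Quotient.exact hxy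
      rcases hxy' with h1 | ⟨h1, h2⟩ | ⟨h1, h2⟩
      · exact Subtype.ext (Quotient.sound h1)
      · exact absurd (r.symm h2) hy'
      · exact absurd h1 hx'
    · rintro ⟨x⟩
      by_cases hx : r x k
      · refine ⟨⟨Quotient.mk r h, fun hh => hr (Quotient.exact hh)⟩, ?_⟩
        exact Quotient.sound (s := joinPair r h k) (Or.inr (Or.inl ⟨r.refl h, r.symm hx⟩))
      · exact ⟨⟨Quotient.mk r x, fun hh => hx (Quotient.exact hh)⟩, rfl⟩
  rw [← Nat.card_congr (Equiv.ofBijective f hf), ← Finite.card_option,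
    Nat.card_congr (Equiv.optionSubtypeNe (Quotient.mk r k))]

/-- The equivalence relation of lying in the same cycle. -/
abbrev SC (σ : Perm H) : Setoid H := SameCycle.setoid σ

theorem SC_le_iff {σ : Perm H} {t : Setoid H} : SC σ ≤ t ↔ ∀ x, t x (σ x) := by
  refine ⟨fun h x => h (SameCycle.refl σ x |> sameCycle_apply_right.2), fun h => ?_⟩
  have hn : ∀ (n : ℕ) x, t x ((σ ^ n) x) := by
    intro n
    induction n with
    | zero => intro x; exact t.refl x
    | succ n ih => intro x; rw [pow_succ', mul_apply]; exact t.trans (ih x) (h _)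
  rintro x y ⟨i, rfl⟩
  obtain ⟨n, rfl | rfl⟩ := i.eq_nat_or_neg
  · exact_mod_cast hn n x
  · have := hn n ((σ ^ (-(n : ℤ))) x)
    rw [← mul_apply, ← zpow_natCast, ← zpow_add, add_neg_cancel, zpow_zero, one_apply] at this
    exact t.symm this

theorem SC_one : SC (1 : Perm H) = ⊥ := by
  ext x y
  exact sameCycle_one

theorem SC_inv (σ : Perm H) : SC σ⁻¹ = SC σ := by
  ext x y
  exact sameCycle_inv

/-- The number of cycles of a permutation, fixed points included. -/
noncomputable def cycles (σ : Perm H) : ℕ := Nat.card (PermCycles σ)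

/-- The orbit relation of the group generated by two permutations. -/
def orbitRel (σ α : Perm H) : Setoid H := SC σ ⊔ SC α

theorem orbitRel_le_iff {σ α : Perm H} {t : Setoid H} :
    orbitRel σ α ≤ t ↔ (∀ x, t x (σ x)) ∧ ∀ x, t x (α x) := by
  rw [orbitRel, sup_le_iff, SC_le_iff, SC_le_iff]

theorem orbitRel_left (σ α : Perm H) (x : H) : orbitRel σ α x (σ x) :=
  (orbitRel_le_iff.1 le_rfl).1 x

theorem orbitRel_right (σ α : Perm H) (x : H) : orbitRel σ α x (α x) :=
  (orbitRel_le_iff.1 le_rfl).2 x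

theorem SC_le_orbitRel (σ α : Perm H) : SC σ ≤ orbitRel σ α := le_sup_left

theorem pow_injOn_minimalPeriod {σ : Perm H} {h : H} {i j : ℕ}
    (hi : i < Function.minimalPeriod σ h) (hj : j < Function.minimalPeriod σ h)
    (hij : (σ ^ i) h = (σ ^ j) h) : i = j := by
  refine Function.iterate_injOn_Iio_minimalPeriod (f := σ) (x := h) hi hj ?_
  simpa [iterate_eq_pow] using hij

theorem minimalPeriod_pos [Finite H] (σ : Perm H) (h : H) : 0 < Function.minimalPeriod σ h :=
  Function.minimalPeriod_pos_of_mem_periodicPts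
    (σ.injective.mem_periodicPts h)

theorem pow_minimalPeriod_apply (σ : Perm H) (h : H) :
    (σ ^ Function.minimalPeriod σ h) h = h := by
  rw [← iterate_eq_pow]; exact Function.iterate_minimalPeriod

theorem pow_mod_apply {σ : Perm H} {h : H} {m : ℕ} (hm : (σ ^ m) h = h) (n : ℕ) :
    (σ ^ (n % m)) h = (σ ^ n) h := by
  rw [← iterate_eq_pow, ← iterate_eq_pow]
  refine Function.IsPeriodicPt.iterate_mod_apply ?_ n
  rw [Function.IsPeriodicPt, Function.IsFixedPt, iterate_eq_pow, hm]

theorem sameCycle_iff_exists_lt [Finite H] {σ : Perm H} {h x : H} :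
    SameCycle σ h x ↔ ∃ i < Function.minimalPeriod σ h, (σ ^ i) h = x := by
  constructor
  · intro hx
    obtain ⟨n, rfl⟩ := hx.exists_nat_pow_eq
    exact ⟨_, Nat.mod_lt n (minimalPeriod_pos σ h), pow_mod_apply (pow_minimalPeriod_apply σ h) n⟩
  · rintro ⟨i, _, rfl⟩
    exact sameCycle_pow_right.2 (SameCycle.refl σ h)

section Swap

variable [DecidableEq H]

theorem rel_swap_apply {t : Setoid H} {h k : H} (ht : t h k) {x y : H} (hxy : t x y) :
    t x (swap h k y) := by
  rw [swap_apply_def]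
  split_ifs with h1 h2
  · subst h1; exact t.trans hxy ht
  · subst h2; exact t.trans hxy (t.symm ht)
  · exact hxy

theorem joinPair_SC_swap_mul (σ : Perm H) (h k : H) :
    joinPair (SC (swap h k * σ)) h k = joinPair (SC σ) h k := by
  have key : ∀ τ : Perm H, joinPair (SC (swap h k * τ)) h k ≤ joinPair (SC τ) h k := fun τ =>
    joinPair_le_iff.2 ⟨SC_le_iff.2 fun x => rel_swap_apply (joinPair_self _ h k)
      (le_joinPair _ h k (SC_le_iff.1 le_rfl x)), joinPair_self _ h k⟩
  refine le_antisymm (key σ) ?_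
  have := key (swap h k * σ)
  rwa [swap_mul_self_mul] at this

theorem joinPair_orbitRel_swap_mul (σ α : Perm H) (h k : H) :
    joinPair (orbitRel (swap h k * σ) (swap h k * α)) h k = joinPair (orbitRel σ α) h k := by
  have key : ∀ τ β : Perm H, joinPair (orbitRel (swap h k * τ) (swap h k * β)) h k ≤
      joinPair (orbitRel τ β) h k := fun τ β =>
    joinPair_le_iff.2 ⟨orbitRel_le_iff.2
      ⟨fun x => rel_swap_apply (joinPair_self _ h k) (le_joinPair _ h k (orbitRel_left τ β x)),
       fun x => rel_swap_apply (joinPair_self _ h k) (le_joinPair _ h k (orbitRel_right τ β x))⟩,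
      joinPair_self _ h k⟩
  refine le_antisymm (key σ α) ?_
  have := key (swap h k * σ) (swap h k * α)
  rwa [swap_mul_self_mul, swap_mul_self_mul] at this

theorem swap_mul_pow_apply {σ : Perm H} {h k : H} {m : ℕ}
    (hm : ∀ i, 0 < i → i < m → (σ ^ i) h ≠ h ∧ (σ ^ i) h ≠ k) {i : ℕ} (hi : i < m) :
    ((swap h k * σ) ^ i) h = (σ ^ i) h := by
  induction i with
  | zero => rfl
  | succ i ih =>
    have h1 := hm (i + 1) (by omega) hi
    rw [pow_succ', mul_apply, ih (by omega), mul_apply, ← mul_apply σ, ← pow_succ',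
      swap_apply_of_ne_of_ne h1.1 h1.2]

/-- If `h` and `k = σ ^ m h` lie in one cycle of `σ`, then multiplying by the transposition of
`h` and `k` cuts that cycle, and the part through `h` is the arc from `h` to just before `k`. -/
theorem sameCycle_swap_mul_iff [Finite H] {σ : Perm H} {h x : H} {m : ℕ} (h0 : 0 < m)
    (hm : m < Function.minimalPeriod σ h) :
    SameCycle (swap h ((σ ^ m) h) * σ) h x ↔ ∃ i < m, (σ ^ i) h = x := by
  have hne : ∀ i, 0 < i → i < m → (σ ^ i) h ≠ h ∧ (σ ^ i) h ≠ (σ ^ m) h := by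
    intro i hi him
    refine ⟨fun hh => ?_, fun hh => ?_⟩
    · have := pow_injOn_minimalPeriod (σ := σ) (h := h) (i := i) (j := 0) (by omega) (by omega)
        (by simpa using hh)
      omega
    · have := pow_injOn_minimalPeriod (by omega) (by omega) hh
      omega
  have hper : ((swap h ((σ ^ m) h) * σ) ^ m) h = h := by
    obtain ⟨n, rfl⟩ : ∃ n, m = n + 1 := ⟨m - 1, by omega⟩
    rw [pow_succ' (swap h ((σ ^ (n + 1)) h) * σ), mul_apply,
      swap_mul_pow_apply hne (Nat.lt_succ_self n), mul_apply, ← mul_apply σ, ← pow_succ',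
      swap_apply_right]
  constructor
  · intro hx
    obtain ⟨n, rfl⟩ := hx.exists_nat_pow_eq
    refine ⟨n % m, Nat.mod_lt n h0, ?_⟩
    rw [← swap_mul_pow_apply hne (Nat.mod_lt n h0), pow_mod_apply hper]
  · rintro ⟨i, hi, rfl⟩
    rw [← swap_mul_pow_apply hne hi]
    exact sameCycle_pow_right.2 (SameCycle.refl _ h)

theorem not_sameCycle_swap_mul [Finite H] {σ : Perm H} {h k : H} (hk : h ≠ k)
    (hs : SameCycle σ h k) : ¬ SameCycle (swap h k * σ) h k := by
  obtain ⟨m, hm, rfl⟩ := sameCycle_iff_exists_lt.1 hs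
  have h0 : 0 < m := by
    rcases Nat.eq_zero_or_pos m with rfl | h0
    · exact absurd rfl hk
    · exact h0
  rw [sameCycle_swap_mul_iff h0 hm]
  rintro ⟨i, hi, h1⟩
  have := pow_injOn_minimalPeriod (by omega) hm h1
  omega

theorem sameCycle_swap_mul [Finite H] {σ : Perm H} {h k : H}
    (hs : ¬ SameCycle σ h k) : SameCycle (swap h k * σ) h k := by
  have hp := minimalPeriod_pos σ h
  have hne : ∀ i, 0 < i → i < Function.minimalPeriod σ h → (σ ^ i) h ≠ h ∧ (σ ^ i) h ≠ k := by
    intro i hi him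
    refine ⟨fun hh => ?_, fun hh => hs ⟨i, by simpa using hh⟩⟩
    have := pow_injOn_minimalPeriod (i := i) (j := 0) him hp (by simpa using hh)
    omega
  obtain ⟨n, hn⟩ : ∃ n, Function.minimalPeriod σ h = n + 1 := ⟨_, (Nat.succ_pred_eq_of_pos hp).symm⟩
  refine ⟨((n + 1 : ℕ) : ℤ), ?_⟩
  rw [zpow_natCast, pow_succ' (swap h k * σ), mul_apply, swap_mul_pow_apply hne (by omega),
    mul_apply, ← mul_apply σ, ← pow_succ', ← hn, pow_minimalPeriod_apply, swap_apply_left]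

theorem cycles_swap_mul_of_sameCycle [Finite H] {σ : Perm H} {h k : H} (hk : h ≠ k)
    (hs : SameCycle σ h k) : cycles (swap h k * σ) = cycles σ + 1 := by
  rw [cycles, card_quotient_joinPair (not_sameCycle_swap_mul hk hs), joinPair_SC_swap_mul,
    joinPair_eq_self hs, cycles]

theorem cycles_swap_mul_of_not_sameCycle [Finite H] {σ : Perm H} {h k : H}
    (hs : ¬ SameCycle σ h k) : cycles σ = cycles (swap h k * σ) + 1 := by
  rw [cycles, card_quotient_joinPair (r := SC σ) hs, ← joinPair_SC_swap_mul,
    joinPair_eq_self (sameCycle_swap_mul hs), cycles]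

end Swap

/-! ### Euler's inequality -/

/-- `α` is an involution whose non-fixed points are the elements of `S`. The remaining points of
`H` belong to the cycles at the vertices but carry no edge. -/
def IsPairing (S : Finset H) (α : Perm H) : Prop :=
  (∀ x, α (α x) = x) ∧ ∀ x, α x ≠ x ↔ x ∈ S

theorem IsPairing.apply_mem {S : Finset H} {α : Perm H} (hα : IsPairing S α) {h : H}
    (hh : h ∈ S) : α h ∈ S := by
  rw [← hα.2, hα.1]
  exact fun h1 => (hα.2 h).2 hh h1.symm

theorem isPairing_empty {α : Perm H} : IsPairing (∅ : Finset H) α ↔ α = 1 := by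
  refine ⟨fun h => Equiv.ext fun x => ?_, ?_⟩
  · by_contra hc
    have := (h.2 x).1 hc
    simp at this
  · rintro rfl
    exact ⟨fun x => rfl, fun x => by simp⟩

section

variable [DecidableEq H]

theorem IsPairing.swap_mul {S : Finset H} {α : Perm H} (hα : IsPairing S α) {h k : H}
    (hk : α h = k) : IsPairing ((S.erase h).erase k) (swap h k * α) := by
  have hk' : α k = h := by rw [← hk, hα.1]
  have key : ∀ x, x ≠ h → x ≠ k → (swap h k * α) x = α x := fun x hx hx' => by
    rw [mul_apply, swap_apply_of_ne_of_ne]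
    · rw [← hk']; exact fun hh => hx' (α.injective hh)
    · rw [← hk]; exact fun hh => hx (α.injective hh)
  have e1 : (swap h k * α) h = h := by rw [mul_apply, hk, swap_apply_right]
  have e2 : (swap h k * α) k = k := by rw [mul_apply, hk', swap_apply_left]
  refine ⟨fun x => ?_, fun x => ?_⟩
  · by_cases hx : x = h
    · subst hx; rw [e1, e1]
    by_cases hx' : x = k
    · subst hx'; rw [e2, e2]
    rw [key x hx hx', key, hα.1]
    · rw [← hk']; exact fun hh => hx' (α.injective hh)
    · rw [← hk]; exact fun hh => hx (α.injective hh)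
  · simp only [Finset.mem_erase]
    by_cases hx : x = h
    · subst hx; simp [e1]
    by_cases hx' : x = k
    · subst hx'; simp [e2]
    rw [key x hx hx', hα.2]
    tauto

theorem IsPairing.of_swap_mul {S : Finset H} {β : Perm H} {h k : H} (hhk : h ≠ k)
    (hh : h ∈ S) (hk : k ∈ S) (hβ : IsPairing ((S.erase h).erase k) β) :
    IsPairing S (swap h k * β) ∧ (swap h k * β) h = k := by
  have b1 : β h = h := by
    by_contra hc
    have := (hβ.2 h).1 hc
    simp at this
  have b2 : β k = k := by
    by_contra hc
    have := (hβ.2 k).1 hc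
    simp at this
  have e1 : (swap h k * β) h = k := by rw [mul_apply, b1, swap_apply_left]
  have e2 : (swap h k * β) k = h := by rw [mul_apply, b2, swap_apply_right]
  have ne1 : ∀ x, x ≠ h → β x ≠ h := fun x hx hc => hx (β.injective (hc.trans b1.symm))
  have ne2 : ∀ x, x ≠ k → β x ≠ k := fun x hx hc => hx (β.injective (hc.trans b2.symm))
  have key : ∀ x, x ≠ h → x ≠ k → (swap h k * β) x = β x := fun x hx hx' => by
    rw [mul_apply, swap_apply_of_ne_of_ne (ne1 x hx) (ne2 x hx')]
  refine ⟨⟨fun x => ?_, fun x => ?_⟩, e1⟩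
  · by_cases hx : x = h
    · subst hx; rw [e1, e2]
    by_cases hx' : x = k
    · subst hx'; rw [e2, e1]
    rw [key x hx hx', key _ (ne1 x hx) (ne2 x hx'), hβ.1]
  · by_cases hx : x = h
    · subst hx; simp [e1, hh, hhk.symm]
    by_cases hx' : x = k
    · subst hx'; simp [e2, hk, hhk]
    rw [key x hx hx', hβ.2]
    simp [hx, hx']

theorem card_erase_erase {S : Finset H} {h k : H} (hhk : h ≠ k) (hh : h ∈ S) (hk : k ∈ S) :
    ((S.erase h).erase k).card + 2 = S.card := by
  rw [Finset.card_erase_of_mem (Finset.mem_erase.2 ⟨hhk.symm, hk⟩), Finset.card_erase_of_mem hh]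
  have : 1 < S.card := Finset.one_lt_card.2 ⟨h, hh, k, hk, hhk⟩
  omega

theorem inv_mul_swap_mul (σ α : Perm H) (h k : H) :
    (swap h k * σ)⁻¹ * (swap h k * α) = σ⁻¹ * α := by
  group

/-- Euler's inequality `V - E + F ≤ 2 K`, where `K` is the number of connected components and
`2 E` is the number of elements of `S`. It is proved by contracting one edge at a time. -/
theorem euler_inequality [Finite H] (σ : Perm H) {S : Finset H} {α : Perm H}
    (hα : IsPairing S α) :
    2 * (cycles σ + cycles (σ⁻¹ * α)) ≤ S.card + 4 * Nat.card (Quotient (orbitRel σ α)) := by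
  induction hn : S.card using Nat.strong_induction_on generalizing S σ α with
  | _ n ih =>
    subst hn
    rcases S.eq_empty_or_nonempty with rfl | ⟨h, hh⟩
    · obtain rfl := isPairing_empty.1 hα
      have h1 : orbitRel σ 1 = SC σ := by rw [orbitRel, SC_one, sup_bot_eq]
      have h2 : cycles (σ⁻¹ * 1) = cycles σ := by
        rw [mul_one]
        change Nat.card (Quotient (SC σ⁻¹)) = _
        rw [SC_inv, cycles]
      rw [h2, h1, cycles, Finset.card_empty]
      change _ ≤ 0 + 4 * Nat.card (PermCycles σ)
      omega
    · set k := α h with hk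
      have hkS : k ∈ S := hα.apply_mem hh
      have hhk : h ≠ k := ((hα.2 h).2 hh).symm
      have hc := card_erase_erase hhk hh hkS
      have hi := ih _ (by omega) (swap h k * σ) (hα.swap_mul hk.symm) rfl
      rw [inv_mul_swap_mul] at hi
      have ho : joinPair (orbitRel (swap h k * σ) (swap h k * α)) h k = orbitRel σ α := by
        rw [joinPair_orbitRel_swap_mul]
        exact joinPair_eq_self (orbitRel_right σ α h)
      by_cases hs : SameCycle σ h k
      · rw [cycles_swap_mul_of_sameCycle hhk hs] at hi
        by_cases hr : orbitRel (swap h k * σ) (swap h k * α) h k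
        · rw [joinPair_eq_self hr] at ho
          rw [ho] at hi
          omega
        · rw [card_quotient_joinPair hr, ho] at hi
          omega
      · have h1 := cycles_swap_mul_of_not_sameCycle hs
        rw [joinPair_eq_self (SC_le_orbitRel _ _ (sameCycle_swap_mul hs))] at ho
        rw [ho] at hi
        omega

end

end PlanarCount

/-! ### Planar gluings and the contraction of an edge -/

namespace PlanarCount

open Equiv Equiv.Perm

variable {H : Type}

/-- A connected planar gluing: the pairing `α` of the points in `S` makes the vertices given by
the cycles of `σ` into a connected graph with `V - E + F = 2`, where `2 E` is the number of
elements of `S`. -/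
def IsPlanarGluing (σ : Perm H) (S : Finset H) (α : Perm H) : Prop :=
  IsPairing S α ∧ (∀ x y, orbitRel σ α x y) ∧
    2 * (cycles σ + cycles (σ⁻¹ * α)) = S.card + 4

/-- The number of connected planar gluings. -/
noncomputable def gluingCount (σ : Perm H) (S : Finset H) : ℕ :=
  Nat.card {α // IsPlanarGluing σ S α}

/-- A pairing that respects `p` and for which both `p` and its complement are connected, with
`V - E + F = 4`, as for two disjoint spheres. -/
def IsSplitGluing (σ : Perm H) (S : Finset H) (p : H → Prop) (β : Perm H) : Prop :=
  IsPairing S β ∧ (∀ x, p (β x) ↔ p x) ∧ (∀ x y, p x → p y → orbitRel σ β x y) ∧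
    (∀ x y, ¬ p x → ¬ p y → orbitRel σ β x y) ∧
    2 * (cycles σ + cycles (σ⁻¹ * β)) = S.card + 8

theorem card_subtype_eq_sum {ι γ : Type*} [Finite γ] {A : γ → Prop} {P : Finset ι}
    {B : ι → γ → Prop} (h1 : ∀ c, A c ↔ ∃ j ∈ P, B j c)
    (h2 : ∀ j ∈ P, ∀ j' ∈ P, ∀ c, B j c → B j' c → j = j') :
    Nat.card {c // A c} = ∑ j ∈ P, Nat.card {c // B j c} := by
  classical
  have := Fintype.ofFinite γ
  simp only [Nat.card_eq_fintype_card, Fintype.card_subtype]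
  rw [← Finset.card_biUnion]
  · congr 1
    ext c
    simp [h1]
  · intro j hj j' hj' hne
    rw [Function.onFun, Finset.disjoint_left]
    intro c hc hc'
    simp only [Finset.mem_filter, Finset.mem_univ, true_and] at hc hc'
    exact hne (h2 j hj j' hj' c hc hc')

theorem card_quotient_eq_one {r : Setoid H} (h : ∀ x y, r x y) (x : H) :
    Nat.card (Quotient r) = 1 := by
  rw [Nat.card_eq_one_iff_unique]
  refine ⟨⟨?_⟩, ⟨Quotient.mk r x⟩⟩
  rintro ⟨a⟩ ⟨b⟩
  exact Quotient.sound (h a b)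

/-- If the cycle relation and the pairing both respect `p`, so does the orbit relation. -/
theorem orbitRel_iff_of_invariant {σ α : Perm H} {p : H → Prop} (hσ : ∀ x, p (σ x) ↔ p x)
    (hα : ∀ x, p (α x) ↔ p x) {x y : H} (h : orbitRel σ α x y) : p x ↔ p y := by
  let t : Setoid H := ⟨fun x y => p x ↔ p y, ⟨fun _ => Iff.rfl, Iff.symm, Iff.trans⟩⟩
  have : orbitRel σ α ≤ t := orbitRel_le_iff.2 ⟨fun x => (hσ x).symm, fun x => (hα x).symm⟩
  exact this h

theorem orbitRel_subtypePerm_iff {σ α : Perm H} {p : H → Prop} (hσ : ∀ x, p (σ x) ↔ p x)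
    (hα : ∀ x, p (α x) ↔ p x) (x y : {x // p x}) :
    orbitRel (σ.subtypePerm hσ) (α.subtypePerm hα) x y ↔ orbitRel σ α x y := by
  constructor
  · intro h
    have : orbitRel (σ.subtypePerm hσ) (α.subtypePerm hα) ≤
        (orbitRel σ α).comap Subtype.val :=
      orbitRel_le_iff.2 ⟨fun x => orbitRel_left σ α x, fun x => orbitRel_right σ α x⟩
    exact this h
  · intro h
    let r := orbitRel (σ.subtypePerm hσ) (α.subtypePerm hα)
    let t : Setoid H :=
      { r := fun x y => (p x ↔ p y) ∧ ∀ (hx : p x) (hy : p y), r ⟨x, hx⟩ ⟨y, hy⟩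
        iseqv :=
          { refl := fun x => ⟨Iff.rfl, fun _ _ => r.refl _⟩
            symm := fun h => ⟨h.1.symm, fun hx hy => r.symm (h.2 hy hx)⟩
            trans := fun h h' => ⟨h.1.trans h'.1, fun hx hz =>
              r.trans (h.2 hx (h.1.1 hx)) (h'.2 (h.1.1 hx) hz)⟩ } }
    have : orbitRel σ α ≤ t := orbitRel_le_iff.2
      ⟨fun x => ⟨(hσ x).symm, fun hx _ => orbitRel_left (σ.subtypePerm hσ) _ ⟨x, hx⟩⟩,
       fun x => ⟨(hα x).symm, fun hx _ => orbitRel_right (σ.subtypePerm hσ) _ ⟨x, hx⟩⟩⟩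
    exact (this h).2 x.2 y.2

theorem cycles_eq_add [Finite H] {π : Perm H} {p : H → Prop} (hπ : ∀ x, p (π x) ↔ p x)
    (hπ' : ∀ x, ¬ p (π x) ↔ ¬ p x) :
    cycles π = cycles (π.subtypePerm hπ) + cycles (π.subtypePerm (p := fun x => ¬ p x) hπ') := by
  let f : PermCycles (π.subtypePerm hπ) ⊕ PermCycles (π.subtypePerm (p := fun x => ¬ p x) hπ') →
      PermCycles π :=
    Sum.elim
      (Quotient.map' Subtype.val fun _ _ h => sameCycle_subtypePerm.1 h)
      (Quotient.map' Subtype.val fun _ _ h => sameCycle_subtypePerm.1 h)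
  have hs : ∀ x y, SameCycle π x y → (p x ↔ p y) := fun x y h =>
    orbitRel_iff_of_invariant hπ (α := π) hπ (SC_le_orbitRel π π h)
  have hf : Function.Bijective f := by
    constructor
    · rintro (⟨⟨x⟩⟩ | ⟨⟨x⟩⟩) (⟨⟨y⟩⟩ | ⟨⟨y⟩⟩) hxy
      · exact congrArg Sum.inl (Quotient.sound (sameCycle_subtypePerm.2 (Quotient.exact hxy)))
      · exact absurd ((hs x y (Quotient.exact hxy)).1 x.2) y.2
      · exact absurd ((hs x y (Quotient.exact hxy)).2 y.2) x.2
      · exact congrArg Sum.inr (Quotient.sound (sameCycle_subtypePerm.2 (Quotient.exact hxy)))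
    · rintro ⟨x⟩
      by_cases hx : p x
      · exact ⟨Sum.inl (Quotient.mk _ ⟨x, hx⟩), rfl⟩
      · exact ⟨Sum.inr (Quotient.mk _ ⟨x, hx⟩), rfl⟩
  rw [cycles, ← Nat.card_congr (Equiv.ofBijective f hf), Nat.card_sum, cycles, cycles]

theorem inv_mul_apply_iff {σ β : Perm H} {p : H → Prop} (hσ : ∀ x, p (σ x) ↔ p x)
    (hβ : ∀ x, p (β x) ↔ p x) (x : H) : p ((σ⁻¹ * β) x) ↔ p x := by
  rw [← hσ, ← mul_apply, mul_inv_cancel_left, hβ]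

theorem inv_subtypePerm_mul {σ β : Perm H} {p : H → Prop} (hσ : ∀ x, p (σ x) ↔ p x)
    (hβ : ∀ x, p (β x) ↔ p x) :
    (σ.subtypePerm hσ)⁻¹ * β.subtypePerm hβ =
      (σ⁻¹ * β).subtypePerm (inv_mul_apply_iff hσ hβ) :=
  Equiv.ext fun _ => rfl

theorem IsPairing.subtypePerm {S : Finset H} {α : Perm H} (hα : IsPairing S α) {p : H → Prop}
    [DecidablePred p] (hp : ∀ x, p (α x) ↔ p x) :
    IsPairing (S.subtype p) (α.subtypePerm hp) := by
  refine ⟨fun x => Subtype.ext (hα.1 x), fun x => ?_⟩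
  rw [Finset.mem_subtype, ← hα.2, Ne, Subtype.ext_iff]
  rfl

section Split

variable [DecidableEq H] {p : H → Prop} [DecidablePred p]

theorem isSplitGluing_iff [Finite H] {σ : Perm H} {S : Finset H} {β : Perm H}
    (hσ : ∀ x, p (σ x) ↔ p x) (hσ' : ∀ x, ¬ p (σ x) ↔ ¬ p x) (hβ : ∀ x, p (β x) ↔ p x)
    (hβ' : ∀ x, ¬ p (β x) ↔ ¬ p x) (hne : ∃ x, p x) (hne' : ∃ x, ¬ p x) :
    IsSplitGluing σ S p β ↔
      IsPlanarGluing (σ.subtypePerm hσ) (S.subtype p) (β.subtypePerm hβ) ∧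
      IsPlanarGluing (σ.subtypePerm hσ') (S.subtype fun x => ¬ p x) (β.subtypePerm hβ') := by
  have hc : S.card = (S.subtype p).card + (S.subtype fun x => ¬ p x).card := by
    rw [Finset.card_subtype, Finset.card_subtype, Finset.card_filter_add_card_filter_not]
  have hV := cycles_eq_add hσ hσ'
  have hF : cycles (σ⁻¹ * β) = cycles ((σ.subtypePerm hσ)⁻¹ * β.subtypePerm hβ) +
      cycles ((σ.subtypePerm hσ')⁻¹ * β.subtypePerm (p := fun x => ¬ p x) hβ') := by
    rw [inv_subtypePerm_mul, inv_subtypePerm_mul]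
    exact cycles_eq_add _ _
  constructor
  · rintro ⟨h1, -, h3, h4, h5⟩
    have c1 : ∀ x y, orbitRel (σ.subtypePerm hσ) (β.subtypePerm hβ) x y := fun x y =>
      (orbitRel_subtypePerm_iff hσ hβ x y).2 (h3 x y x.2 y.2)
    have c2 : ∀ x y, orbitRel (σ.subtypePerm hσ') (β.subtypePerm hβ') x y := fun x y =>
      (orbitRel_subtypePerm_iff (p := fun x => ¬ p x) hσ' hβ' x y).2 (h4 x.1 y.1 x.2 y.2)
    have p1 := h1.subtypePerm hβ
    have p2 := h1.subtypePerm (p := fun x => ¬ p x) hβ'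
    have e1 := euler_inequality (σ.subtypePerm hσ) p1
    have e2 := euler_inequality (σ.subtypePerm hσ') p2
    obtain ⟨x, hx⟩ := hne
    obtain ⟨y, hy⟩ := hne'
    rw [card_quotient_eq_one c1 ⟨x, hx⟩] at e1
    rw [card_quotient_eq_one c2 ⟨y, hy⟩] at e2
    exact ⟨⟨p1, c1, by omega⟩, ⟨p2, c2, by omega⟩⟩
  · rintro ⟨⟨p1, c1, e1⟩, ⟨p2, c2, e2⟩⟩
    refine ⟨⟨fun x => ?_, fun x => ?_⟩, hβ,
      fun x y hx hy => (orbitRel_subtypePerm_iff hσ hβ ⟨x, hx⟩ ⟨y, hy⟩).1 (c1 _ _),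
      fun x y hx hy => (orbitRel_subtypePerm_iff (p := fun x => ¬ p x) hσ' hβ'
        ⟨x, hx⟩ ⟨y, hy⟩).1 (c2 _ _), by omega⟩
    · by_cases hx : p x
      · exact congrArg Subtype.val (p1.1 ⟨x, hx⟩)
      · exact congrArg Subtype.val (p2.1 ⟨x, hx⟩)
    · by_cases hx : p x
      · have := p1.2 ⟨x, hx⟩
        rw [Finset.mem_subtype, Ne, Subtype.ext_iff] at this
        exact this
      · have := p2.2 ⟨x, hx⟩
        rw [Finset.mem_subtype, Ne, Subtype.ext_iff] at this
        exact this

theorem card_isSplitGluing [Finite H] {σ : Perm H} {S : Finset H}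
    (hσ : ∀ x, p (σ x) ↔ p x) (hσ' : ∀ x, ¬ p (σ x) ↔ ¬ p x)
    (hne : ∃ x, p x) (hne' : ∃ x, ¬ p x) :
    Nat.card {β // IsSplitGluing σ S p β} =
      gluingCount (σ.subtypePerm hσ) (S.subtype p) *
        gluingCount (σ.subtypePerm hσ') (S.subtype fun x => ¬ p x) := by
  rw [gluingCount, gluingCount, ← Nat.card_prod]
  have hinv : ∀ (a : Perm {x // p x}) (b : Perm {x // ¬ p x}) x,
      p (Perm.subtypeCongr a b x) ↔ p x := by
    intro a b x
    by_cases hx : p x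
    · rw [Perm.subtypeCongr.left_apply _ _ hx]; exact iff_of_true (a ⟨x, hx⟩).2 hx
    · rw [Perm.subtypeCongr.right_apply _ _ hx]; exact iff_of_false (b ⟨x, hx⟩).2 hx
  have hl : ∀ (a : Perm {x // p x}) (b : Perm {x // ¬ p x}),
      (Perm.subtypeCongr a b).subtypePerm (hinv a b) = a := fun a b => by
    ext x
    rw [subtypePerm_apply]
    exact Perm.subtypeCongr.left_apply_subtype a b x
  have hr : ∀ (a : Perm {x // p x}) (b : Perm {x // ¬ p x}),
      (Perm.subtypeCongr a b).subtypePerm (fun x => not_congr (hinv a b x)) = b := fun a b => by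
    ext x
    rw [subtypePerm_apply]
    exact Perm.subtypeCongr.right_apply_subtype a b x
  refine Nat.card_congr
    { toFun := fun β =>
        ⟨⟨β.1.subtypePerm β.2.2.1, ((isSplitGluing_iff hσ hσ' β.2.2.1
            (fun x => not_congr (β.2.2.1 x)) hne hne').1 β.2).1⟩,
          ⟨β.1.subtypePerm fun x => not_congr (β.2.2.1 x), ((isSplitGluing_iff hσ hσ' β.2.2.1
            (fun x => not_congr (β.2.2.1 x)) hne hne').1 β.2).2⟩⟩
      invFun := fun a => ⟨Perm.subtypeCongr a.1.1 a.2.1,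
        (isSplitGluing_iff hσ hσ' (hinv _ _) (fun x => not_congr (hinv _ _ x)) hne hne').2
          ⟨by rw [hl]; exact a.1.2, by rw [hr]; exact a.2.2⟩⟩
      left_inv := ?_
      right_inv := ?_ }
  · rintro ⟨β, hβ⟩
    refine Subtype.ext (Equiv.ext fun x => ?_)
    change Perm.subtypeCongr _ _ x = β x
    by_cases hx : p x
    · rw [Perm.subtypeCongr.left_apply _ _ hx, subtypePerm_apply]
    · rw [Perm.subtypeCongr.right_apply _ _ hx, subtypePerm_apply]
  · rintro ⟨⟨a, ha⟩, ⟨b, hb⟩⟩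
    simp only [Prod.mk.injEq, Subtype.mk.injEq]
    exact ⟨hl a b, hr a b⟩

end Split

section Contract

variable [DecidableEq H] {σ : Perm H} {S : Finset H} {h k : H}

/-- Left multiplication by the transposition of `h` and `k` carries pairings that match `h` with
`k` to pairings of the remaining points. -/
theorem card_pairing_eq_card_swap_mul (hhk : h ≠ k) (hh : h ∈ S) (hk : k ∈ S)
    {P Q : Perm H → Prop} (hP : ∀ α, P α → IsPairing S α)
    (hQ : ∀ β, Q β → IsPairing ((S.erase h).erase k) β)
    (hPQ : ∀ α, IsPairing S α → α h = k → (P α ↔ Q (swap h k * α))) :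
    Nat.card {α // P α ∧ α h = k} = Nat.card {β // Q β} := by
  refine Nat.card_congr
    ⟨fun α => ⟨swap h k * α.1, (hPQ _ (hP _ α.2.1) α.2.2).1 α.2.1⟩,
     fun β => ⟨swap h k * β.1, ?_, ((hQ _ β.2).of_swap_mul hhk hh hk).2⟩,
     fun α => Subtype.ext (swap_mul_self_mul _ _ _),
     fun β => Subtype.ext (swap_mul_self_mul _ _ _)⟩
  have := (hQ _ β.2).of_swap_mul hhk hh hk
  rw [hPQ _ this.1 this.2, swap_mul_self_mul]
  exact β.2

theorem orbitRel_eq_joinPair {α : Perm H} (hα : α h = k) :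
    orbitRel σ α = joinPair (orbitRel (swap h k * σ) (swap h k * α)) h k := by
  rw [joinPair_orbitRel_swap_mul, joinPair_eq_self]
  rw [← hα]
  exact orbitRel_right σ α h

variable [Finite H]

/-- Contracting an edge between different vertices merges these vertices. -/
theorem card_gluing_of_not_sameCycle (hh : h ∈ S) (hk : k ∈ S) (hs : ¬ SameCycle σ h k) :
    Nat.card {α // IsPlanarGluing σ S α ∧ α h = k} =
      gluingCount (swap h k * σ) ((S.erase h).erase k) := by
  have hhk : h ≠ k := fun hc => hs (hc ▸ SameCycle.refl σ h)
  have hc := card_erase_erase hhk hh hk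
  have hV := cycles_swap_mul_of_not_sameCycle hs
  refine card_pairing_eq_card_swap_mul hhk hh hk (fun α hα => hα.1) (fun β hβ => hβ.1) ?_
  intro α h1 h2
  have ho := orbitRel_eq_joinPair (σ := σ) h2
  rw [joinPair_eq_self (SC_le_orbitRel _ _ (sameCycle_swap_mul hs))] at ho
  rw [IsPlanarGluing, IsPlanarGluing, inv_mul_swap_mul, ho]
  refine and_congr (iff_of_true h1 (h1.swap_mul h2)) (and_congr Iff.rfl ?_)
  omega

/-- Contracting a loop splits its vertex; planarity forces the two parts into different
components. -/
theorem card_gluing_of_sameCycle (hhk : h ≠ k) (hh : h ∈ S) (hk : k ∈ S)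
    (hs : SameCycle σ h k) :
    Nat.card {α // IsPlanarGluing σ S α ∧ α h = k} =
      Nat.card {β // IsPairing ((S.erase h).erase k) β ∧
        (∀ x y, joinPair (orbitRel (swap h k * σ) β) h k x y) ∧
        ¬ orbitRel (swap h k * σ) β h k ∧
        2 * (cycles (swap h k * σ) + cycles ((swap h k * σ)⁻¹ * β)) =
          ((S.erase h).erase k).card + 8} := by
  have hc := card_erase_erase hhk hh hk
  have hV := cycles_swap_mul_of_sameCycle hhk hs
  refine card_pairing_eq_card_swap_mul hhk hh hk (fun α hα => hα.1) (fun β hβ => hβ.1) ?_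
  intro α h1 h2
  have ho := orbitRel_eq_joinPair (σ := σ) h2
  rw [IsPlanarGluing, inv_mul_swap_mul, ho]
  refine and_congr (iff_of_true h1 (h1.swap_mul h2)) ⟨?_, ?_⟩
  · rintro ⟨h3, h4⟩
    refine ⟨h3, fun hr => ?_, by omega⟩
    rw [joinPair_eq_self hr] at h3
    have := euler_inequality (swap h k * σ) (h1.swap_mul h2)
    rw [card_quotient_eq_one h3 h, inv_mul_swap_mul] at this
    omega
  · rintro ⟨h3, -, h4⟩
    exact ⟨h3, by omega⟩

end Contract

end PlanarCount

/-! ### Loops and the arcs of a cycle -/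

namespace PlanarCount

open Equiv Equiv.Perm

/-- Summing `f` over the ranks of the elements of a finite set of natural numbers. -/
theorem sum_card_filter_lt {M : Type*} [AddCommMonoid M] (W : Finset ℕ) (f : ℕ → M) :
    ∑ m ∈ W, f (W.filter (· < m)).card = ∑ a ∈ Finset.range W.card, f a := by
  induction W using Finset.induction_on_max with
  | empty => simp
  | insert a s ha ih =>
    have hs : a ∉ s := fun h => lt_irrefl _ (ha a h)
    rw [Finset.sum_insert hs, Finset.card_insert_of_notMem hs, Finset.sum_range_succ, add_comm,
      ← ih]
    congr 1
    · refine Finset.sum_congr rfl fun m hm => ?_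
      rw [Finset.filter_insert, if_neg (by have := ha m hm; omega)]
    · rw [Finset.filter_insert, if_neg (lt_irrefl a), Finset.filter_true_of_mem ha]

variable {H L : Type}

/-- `lab` labels the cycles of `σ`. -/
def IsLabelling (σ : Perm H) (lab : H → L) : Prop := ∀ x y, lab x = lab y ↔ SameCycle σ x y

/-- The number of points of `S` on the cycle labelled `i`. -/
def deg [DecidableEq L] (lab : H → L) (S : Finset H) (i : L) : ℕ :=
  (S.filter fun x => lab x = i).card

section Arcs

variable [Fintype H] [DecidableEq H] {σ : Perm H} {S : Finset H} {h : H}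

open Classical in
/-- As `k` runs through the other points of `S` on the cycle of `h`, the number of points of `S`
strictly between `h` and `k` takes each possible value once. -/
theorem sum_arc {M : Type*} [AddCommMonoid M] (hh : h ∈ S) (f : ℕ → M) :
    ∑ k ∈ (S.erase h).filter (SameCycle σ h),
        f (((S.erase h).erase k).filter (SameCycle (swap h k * σ) h)).card =
      ∑ a ∈ Finset.range ((S.filter (SameCycle σ h)).card - 1), f a := by
  set p := Function.minimalPeriod σ h with hp
  set W : Finset ℕ := (Finset.range p).filter fun m => 0 < m ∧ (σ ^ m) h ∈ S with hW
  have memW : ∀ m, m ∈ W ↔ m < p ∧ 0 < m ∧ (σ ^ m) h ∈ S := fun m => by simp [hW]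
  have inj : Set.InjOn (fun m => (σ ^ m) h) W := fun i hi j hj hij =>
    pow_injOn_minimalPeriod ((memW i).1 hi).1 ((memW j).1 hj).1 hij
  have ne : ∀ m ∈ W, (σ ^ m) h ≠ h := by
    intro m hm hc
    have := pow_injOn_minimalPeriod (i := m) (j := 0) ((memW m).1 hm).1 (minimalPeriod_pos σ h)
      (by simpa using hc)
    have := ((memW m).1 hm).2.1
    omega
  have img : (S.erase h).filter (SameCycle σ h) = W.image fun m => (σ ^ m) h := by
    ext x
    simp only [Finset.mem_filter, Finset.mem_erase, Finset.mem_image]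
    constructor
    · rintro ⟨⟨h1, h2⟩, h3⟩
      obtain ⟨m, hm, rfl⟩ := sameCycle_iff_exists_lt.1 h3
      refine ⟨m, (memW m).2 ⟨hm, Nat.pos_of_ne_zero ?_, h2⟩, rfl⟩
      rintro rfl
      exact h1 rfl
    · rintro ⟨m, hm, rfl⟩
      exact ⟨⟨ne m hm, ((memW m).1 hm).2.2⟩, sameCycle_pow_right.2 (SameCycle.refl σ h)⟩
  have hcard : (S.filter (SameCycle σ h)).card - 1 = W.card := by
    rw [← Finset.card_image_of_injOn inj, ← img, Finset.filter_erase,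
      Finset.card_erase_of_mem (Finset.mem_filter.2 ⟨hh, SameCycle.refl σ h⟩)]
  rw [hcard, ← sum_card_filter_lt, img, Finset.sum_image inj]
  refine Finset.sum_congr rfl fun m hm => ?_
  obtain ⟨hm1, hm2, hm3⟩ := (memW m).1 hm
  rw [← Finset.card_image_of_injOn
    (inj.mono (Finset.coe_subset.2 (Finset.filter_subset (· < m) W)))]
  congr 2
  ext x
  simp only [Finset.mem_filter, Finset.mem_erase, Finset.mem_image,
    sameCycle_swap_mul_iff hm2 hm1]
  constructor
  · rintro ⟨⟨h1, h2, h3⟩, i, hi, rfl⟩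
    refine ⟨i, ⟨(memW i).2 ⟨by omega, Nat.pos_of_ne_zero ?_, h3⟩, hi⟩, rfl⟩
    rintro rfl
    exact h2 rfl
  · rintro ⟨i, ⟨hi, him⟩, rfl⟩
    refine ⟨⟨fun hc => ?_, ne i hi, ((memW i).1 hi).2.2⟩, i, him, rfl⟩
    have := inj hi hm hc
    omega

end Arcs

section Loop

variable {σ : Perm H} {S : Finset H} {h k : H} {lab : H → L}

/-- The union of the cycle of `h` and the cycles with labels in `J`. -/
def side (σ : Perm H) (lab : H → L) (h : H) (J : Finset L) (x : H) : Prop :=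
  SameCycle σ h x ∨ lab x ∈ J

theorem side_left (J : Finset L) : side σ lab h J h := Or.inl (SameCycle.refl _ h)

variable [DecidableEq H]

theorem sameCycle_of_swap_mul (hs : SameCycle σ h k) {x y : H}
    (hxy : SameCycle (swap h k * σ) x y) : SameCycle σ x y := by
  have h1 : joinPair (SC σ) h k x y := by
    rw [← joinPair_SC_swap_mul]; exact Or.inl hxy
  rwa [joinPair_eq_self (r := SC σ) hs] at h1

theorem sameCycle_swap_mul_cases {x y : H} (hxy : SameCycle σ x y) :
    SameCycle (swap h k * σ) x y ∨
      (SameCycle (swap h k * σ) x h ∧ SameCycle (swap h k * σ) k y) ∨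
      (SameCycle (swap h k * σ) x k ∧ SameCycle (swap h k * σ) h y) := by
  have h1 : joinPair (SC σ) h k x y := Or.inl hxy
  rw [← joinPair_SC_swap_mul] at h1
  exact h1

theorem side_apply_iff (hl : IsLabelling σ lab) (hs : SameCycle σ h k) (J : Finset L) (x : H) :
    side (swap h k * σ) lab h J ((swap h k * σ) x) ↔ side (swap h k * σ) lab h J x := by
  have : lab ((swap h k * σ) x) = lab x := (hl _ _).2
    (sameCycle_of_swap_mul hs (sameCycle_apply_left.2 (SameCycle.refl _ x)))
  rw [side, side, sameCycle_apply_right, this]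

theorem sameCycle_of_lab_ne (hl : IsLabelling σ lab) (hs : SameCycle σ h k) {x y : H}
    (hx : lab x ≠ lab h) (hxy : lab x = lab y) : SameCycle (swap h k * σ) x y := by
  rcases sameCycle_swap_mul_cases (h := h) (k := k) ((hl x y).1 hxy) with h1 | ⟨h1, -⟩ | ⟨h1, -⟩
  · exact h1
  · exact absurd ((hl x h).2 (sameCycle_of_swap_mul hs h1)) hx
  · exact absurd ((hl x h).2 ((sameCycle_of_swap_mul hs h1).trans hs.symm)) hx

theorem sameCycle_or_of_lab_eq (hl : IsLabelling σ lab) {x : H} (hx : lab x = lab h) :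
    SameCycle (swap h k * σ) h x ∨ SameCycle (swap h k * σ) k x := by
  rcases sameCycle_swap_mul_cases (h := h) (k := k) ((hl h x).1 hx.symm) with h1 | ⟨-, h1⟩ | ⟨-, h1⟩
  · exact Or.inl h1
  · exact Or.inr h1
  · exact Or.inl h1

theorem not_side_right [Finite H] (hl : IsLabelling σ lab) (hhk : h ≠ k) (hs : SameCycle σ h k)
    {J : Finset L} (hJ : lab h ∉ J) : ¬ side (swap h k * σ) lab h J k := by
  rintro (h1 | h1)
  · exact not_sameCycle_swap_mul hhk hs h1
  · rw [← (hl h k).2 hs] at h1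
    exact hJ h1

theorem isLabelling_side (hl : IsLabelling σ lab) (hs : SameCycle σ h k) {J : Finset L}
    (hJ : lab h ∉ J) :
    IsLabelling ((swap h k * σ).subtypePerm (side_apply_iff hl hs J)) fun x => lab x.1 := by
  rintro ⟨x, hx⟩ ⟨y, hy⟩
  rw [sameCycle_subtypePerm]
  refine ⟨fun hxy => ?_, fun hxy => (hl x y).2 (sameCycle_of_swap_mul hs hxy)⟩
  by_cases hxh : lab x = lab h
  · rcases hx with hx | hx
    · rcases hy with hy | hy
      · exact hx.symm.trans hy
      · exact absurd (hxy.symm.trans hxh ▸ hy) hJ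
    · exact absurd (hxh ▸ hx) hJ
  · exact sameCycle_of_lab_ne hl hs hxh hxy

theorem isLabelling_not_side (hl : IsLabelling σ lab) (hs : SameCycle σ h k) (J : Finset L) :
    IsLabelling ((swap h k * σ).subtypePerm
      (p := fun x => ¬ side (swap h k * σ) lab h J x)
      (fun x => not_congr (side_apply_iff hl hs J x))) fun x => lab x.1 := by
  rintro ⟨x, hx⟩ ⟨y, hy⟩
  rw [sameCycle_subtypePerm]
  refine ⟨fun hxy => ?_, fun hxy => (hl x y).2 (sameCycle_of_swap_mul hs hxy)⟩
  by_cases hxh : lab x = lab h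
  · have h1 := (sameCycle_or_of_lab_eq (k := k) hl hxh).resolve_left fun hc => hx (Or.inl hc)
    have h2 := (sameCycle_or_of_lab_eq (k := k) hl (hxy.symm.trans hxh)).resolve_left
      fun hc => hy (Or.inl hc)
    exact h1.symm.trans h2
  · exact sameCycle_of_lab_ne hl hs hxh hxy

/-- For a gluing that splits along `side`, the side of `h` is its connected component. -/
theorem side_iff_orbitRel (hl : IsLabelling σ lab) (hs : SameCycle σ h k)
    {J : Finset L} {β : Perm H}
    (hβ : IsSplitGluing (swap h k * σ) S (side (swap h k * σ) lab h J) β) (x : H) :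
    side (swap h k * σ) lab h J x ↔ orbitRel (swap h k * σ) β h x := by
  refine ⟨fun hx => hβ.2.2.1 h x (side_left J) hx, fun hx => ?_⟩
  exact (orbitRel_iff_of_invariant (side_apply_iff hl hs J) hβ.2.1 hx).1 (side_left J)

/-- The planar gluings in which the edge from `h` to `k` is a loop are sorted by the set `J` of the
labels of the vertices on the side of `h`. -/
theorem card_gluing_loop [Fintype H] [DecidableEq L] (hl : IsLabelling σ lab)
    (hhk : h ≠ k) (hh : h ∈ S) (hk : k ∈ S)
    (hs : SameCycle σ h k) :
    Nat.card {α // IsPlanarGluing σ S α ∧ α h = k} =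
      ∑ J ∈ ((Finset.univ.image lab).erase (lab h)).powerset,
        Nat.card {β // IsSplitGluing (swap h k * σ) ((S.erase h).erase k)
          (side (swap h k * σ) lab h J) β} := by
  classical
  rw [card_gluing_of_sameCycle hhk hh hk hs]
  have hk' : lab k = lab h := ((hl h k).2 hs).symm
  refine card_subtype_eq_sum (fun β => ⟨?_, ?_⟩) ?_
  · rintro ⟨h1, h2, h3, h4⟩
    set r := orbitRel (swap h k * σ) β
    have hcover : ∀ x, r h x ∨ r k x := by
      intro x
      rcases h2 h x with h5 | ⟨-, h5⟩ | ⟨-, h5⟩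
      · exact Or.inl h5
      · exact Or.inr h5
      · exact Or.inl h5
    refine ⟨((Finset.univ.image lab).erase (lab h)).filter fun i => ∃ x, lab x = i ∧ r h x,
      by simp, ?_⟩
    have key : ∀ x, side (swap h k * σ) lab h (((Finset.univ.image lab).erase (lab h)).filter
        fun i => ∃ x, lab x = i ∧ r h x) x ↔ r h x := by
      intro x
      rw [side, Finset.mem_filter, Finset.mem_erase]
      constructor
      · rintro (h5 | ⟨⟨h5, -⟩, y, h6, h7⟩)
        · exact SC_le_orbitRel _ _ h5
        · exact r.trans h7
            (SC_le_orbitRel _ _ (sameCycle_of_lab_ne hl hs (h6 ▸ h5) h6))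
      · intro h5
        by_cases hx : lab x = lab h
        · refine Or.inl ((sameCycle_or_of_lab_eq (k := k) hl hx).resolve_right fun h6 => ?_)
          exact h3 (r.trans h5 (r.symm (SC_le_orbitRel _ _ h6)))
        · exact Or.inr ⟨⟨hx, by simp⟩, x, rfl, h5⟩
    refine ⟨h1, fun x => ?_, fun x y hx hy => ?_, fun x y hx hy => ?_, h4⟩
    · rw [key, key]
      exact ⟨fun h5 => r.trans h5 (r.symm (orbitRel_right _ _ x)),
        fun h5 => r.trans h5 (orbitRel_right _ _ x)⟩
    · rw [key] at hx hy
      exact r.trans (r.symm hx) hy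
    · rw [key] at hx hy
      exact r.trans (r.symm ((hcover x).resolve_left hx)) ((hcover y).resolve_left hy)
  · rintro ⟨J, hJ, hβ⟩
    have hJ' : lab h ∉ J := fun hc => by simpa using Finset.mem_powerset.1 hJ hc
    have hnk := not_side_right hl hhk hs hJ'
    refine ⟨hβ.1, fun x y => ?_, fun hr => hnk ((side_iff_orbitRel hl hs hβ k).2 hr), hβ.2.2.2.2⟩
    by_cases hx : side (swap h k * σ) lab h J x <;> by_cases hy : side (swap h k * σ) lab h J y
    · exact Or.inl (hβ.2.2.1 x y hx hy)
    · exact Or.inr (Or.inl ⟨hβ.2.2.1 x h hx (side_left J), hβ.2.2.2.1 k y hnk hy⟩)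
    · exact Or.inr (Or.inr ⟨hβ.2.2.2.1 x k hx hnk, hβ.2.2.1 h y (side_left J) hy⟩)
    · exact Or.inl (hβ.2.2.2.1 x y hx hy)
  · have key : ∀ J ∈ ((Finset.univ.image lab).erase (lab h)).powerset,
        ∀ J' ∈ ((Finset.univ.image lab).erase (lab h)).powerset, ∀ β,
        IsSplitGluing (swap h k * σ) ((S.erase h).erase k) (side (swap h k * σ) lab h J) β →
        IsSplitGluing (swap h k * σ) ((S.erase h).erase k) (side (swap h k * σ) lab h J') β →
        J ⊆ J' := by
      intro J hJ J' hJ' β hβ hβ' i hi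
      have h1 := Finset.mem_powerset.1 hJ hi
      rw [Finset.mem_erase, Finset.mem_image] at h1
      obtain ⟨h1, x, -, rfl⟩ := h1
      have h2 := (side_iff_orbitRel hl hs hβ x).1 (Or.inr hi)
      rcases (side_iff_orbitRel hl hs hβ' x).2 h2 with h3 | h3
      · exact absurd ((hl h x).2 (sameCycle_of_swap_mul hs h3)).symm h1
      · exact h3
    exact fun J hJ J' hJ' β hβ hβ' => Finset.Subset.antisymm (key J hJ J' hJ' β hβ hβ')
      (key J' hJ' J hJ β hβ' hβ)

end Loop

end PlanarCount

/-! ### The recursion for the number of planar gluings -/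

namespace PlanarCount

open Equiv Equiv.Perm

variable {H L : Type}

/-- The conditions that determine the number `cc I d` of connected planar gluings whose vertices
are labelled by `I` and have degrees `d`: its value when there are no edges, and the recursion
obtained by contracting the edge at a chosen half-edge of the vertex `i`. That edge either leads
to another vertex `j`, or it is a loop, which cuts the sphere into two. -/
structure PlanarRecursion [DecidableEq L] (cc : Finset L → (L → ℕ) → ℚ) : Prop where
  congr : ∀ I d d', (∀ i ∈ I, d i = d' i) → cc I d = cc I d'
  base : ∀ I d, I.Nonempty → (∀ i ∈ I, d i = 0) → cc I d = if I.card = 1 then 1 else 0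
  step : ∀ I d, ∀ i ∈ I, 1 ≤ d i → cc I d =
    ∑ j ∈ I.erase i, (d j : ℚ) * cc (I.erase j) (Function.update d i (d i + d j - 2)) +
    ∑ a ∈ Finset.range (d i - 1), ∑ J ∈ (I.erase i).powerset,
      cc (insert i J) (Function.update d i a) *
        cc (insert i (I.erase i \ J)) (Function.update d i (d i - 2 - a))

section Degrees

variable [DecidableEq L] {lab : H → L} {S : Finset H} {h k : H}

/-- The labels after the vertex of `k` has been merged into the vertex of `h`. -/
def mergeLab (lab : H → L) (h k x : H) : L := if lab x = lab k then lab h else lab x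

theorem image_mergeLab [Fintype H] (hne : lab h ≠ lab k) :
    Finset.univ.image (mergeLab lab h k) = (Finset.univ.image lab).erase (lab k) := by
  ext i
  simp only [Finset.mem_image, Finset.mem_univ, true_and, Finset.mem_erase, mergeLab]
  constructor
  · rintro ⟨x, rfl⟩
    split_ifs with hx
    · exact ⟨hne, h, rfl⟩
    · exact ⟨hx, x, rfl⟩
  · rintro ⟨hi, x, rfl⟩
    exact ⟨x, if_neg hi⟩

theorem deg_subtype (p : H → Prop) [DecidablePred p] (i : L) :
    deg (fun x : {x // p x} => lab x.1) (S.subtype p) i =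
      ((S.filter fun x => lab x = i).filter p).card := by
  rw [deg, ← Finset.card_subtype p (S.filter fun x => lab x = i)]
  congr 1
  ext x
  simp

variable [DecidableEq H]

theorem deg_erase_erase (hhk : h ≠ k) (hh : h ∈ S) (hk : k ∈ S) (i : L) :
    deg lab ((S.erase h).erase k) i =
      deg lab S i - (if lab h = i then 1 else 0) - (if lab k = i then 1 else 0) := by
  have key : ∀ (T : Finset H) (x : H), x ∈ T →
      deg lab (T.erase x) i = deg lab T i - if lab x = i then 1 else 0 := by
    intro T x hx
    rw [deg, deg, Finset.filter_erase]
    split_ifs with hi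
    · rw [Finset.card_erase_of_mem (Finset.mem_filter.2 ⟨hx, hi⟩)]
    · have hx' : x ∉ T.filter fun x => lab x = i := fun hc => hi (Finset.mem_filter.1 hc).2
      rw [Finset.erase_eq_of_notMem hx', Nat.sub_zero]
  rw [key _ _ (Finset.mem_erase.2 ⟨hhk.symm, hk⟩), key _ _ hh]

theorem deg_mergeLab (hne : lab h ≠ lab k) (hh : h ∈ S) (hk : k ∈ S) {i : L} (hi : i ≠ lab k) :
    deg (mergeLab lab h k) ((S.erase h).erase k) i =
      Function.update (deg lab S) (lab h) (deg lab S (lab h) + deg lab S (lab k) - 2) i := by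
  have hhk : h ≠ k := fun hc => hne (hc ▸ rfl)
  rw [deg_erase_erase hhk hh hk]
  have e1 : mergeLab lab h k h = lab h := if_neg hne
  have e2 : mergeLab lab h k k = lab h := if_pos rfl
  rw [e1, e2]
  by_cases hih : i = lab h
  · subst hih
    rw [Function.update_self, if_pos rfl]
    have : deg (mergeLab lab h k) S (lab h) = deg lab S (lab h) + deg lab S (lab k) := by
      rw [deg, deg, deg, ← Finset.card_union_of_disjoint]
      · congr 1
        ext x
        simp only [Finset.mem_filter, Finset.mem_union]
        rw [mergeLab]
        split_ifs with hx
        · simp [hx, hne.symm]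
        · simp [hx]
      · rw [Finset.disjoint_filter]
        intro x _ h1 h2
        exact hne (h1.symm.trans h2)
    omega
  · rw [Function.update_of_ne hih, if_neg (Ne.symm hih)]
    rw [Nat.sub_zero, Nat.sub_zero, deg, deg]
    congr 1
    ext x
    simp only [Finset.mem_filter]
    rw [mergeLab]
    refine and_congr Iff.rfl ?_
    split_ifs with hx
    · exact iff_of_false (Ne.symm hih) (hx ▸ Ne.symm hi)
    · rfl

theorem isLabelling_mergeLab [Finite H] {σ : Perm H} (hl : IsLabelling σ lab)
    (hs : ¬ SameCycle σ h k) : IsLabelling (swap h k * σ) (mergeLab lab h k) := by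
  intro x y
  have h1 : SameCycle (swap h k * σ) x y ↔ joinPair (SC σ) h k x y := by
    rw [← joinPair_SC_swap_mul, joinPair_eq_self (sameCycle_swap_mul hs)]
    rfl
  have h2 : joinPair (SC σ) h k x y ↔
      lab x = lab y ∨ (lab x = lab h ∧ lab k = lab y) ∨ (lab x = lab k ∧ lab h = lab y) := by
    rw [hl, hl, hl, hl, hl]; rfl
  rw [h1, h2, mergeLab, mergeLab]
  split_ifs <;> grind

end Degrees

theorem gluingCount_empty [Fintype H] [DecidableEq H] [DecidableEq L] [Nonempty H] {σ : Perm H}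
    {lab : H → L} (hl : IsLabelling σ lab) :
    gluingCount σ ∅ = if (Finset.univ.image lab).card = 1 then 1 else 0 := by
  have h1 : orbitRel σ 1 = SC σ := by rw [orbitRel, SC_one, sup_bot_eq]
  have hiff : (Finset.univ.image lab).card = 1 ↔ ∀ x y, SC σ x y := by
    rw [Finset.card_eq_one]
    constructor
    · rintro ⟨i, hi⟩ x y
      have key : ∀ x, lab x = i := fun x => by
        have : lab x ∈ Finset.univ.image lab := by simp
        rwa [hi, Finset.mem_singleton] at this
      exact (hl x y).1 ((key x).trans (key y).symm)
    · intro h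
      obtain ⟨x⟩ := ‹Nonempty H›
      refine ⟨lab x, ?_⟩
      ext i
      simp only [Finset.mem_image, Finset.mem_univ, true_and, Finset.mem_singleton]
      exact ⟨fun ⟨y, hy⟩ => hy ▸ (hl y x).2 (h y x), fun hi => ⟨x, hi.symm⟩⟩
  split_ifs with hc
  · have hc' := hiff.1 hc
    obtain ⟨x⟩ := ‹Nonempty H›
    have hone : cycles σ = 1 := card_quotient_eq_one hc' x
    have hinv : cycles (σ⁻¹ * 1) = 1 := by
      rw [mul_one]
      change Nat.card (Quotient (SC σ⁻¹)) = 1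
      rw [SC_inv]
      exact hone
    rw [gluingCount, Nat.card_eq_one_iff_unique]
    refine ⟨⟨fun a b => Subtype.ext ?_⟩, ⟨1, isPairing_empty.2 rfl, ?_, ?_⟩⟩
    · rw [isPairing_empty.1 a.2.1, isPairing_empty.1 b.2.1]
    · rwa [h1]
    · rw [hone, hinv, Finset.card_empty]
  · rw [gluingCount, Nat.card_eq_zero]
    refine Or.inl ⟨fun a => hc (hiff.2 ?_)⟩
    have := a.2.2.1
    rwa [isPairing_empty.1 a.2.1, h1] at this

section Step

variable [Fintype H] [DecidableEq H] [DecidableEq L] {σ : Perm H} {S : Finset H} {h k : H}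
  {lab : H → L}

theorem image_side (hl : IsLabelling σ lab) (hs : SameCycle σ h k) {J : Finset L}
    (hJ : J ⊆ (Finset.univ.image lab).erase (lab h))
    [Fintype {x // side (swap h k * σ) lab h J x}] :
    (Finset.univ.image fun x : {x // side (swap h k * σ) lab h J x} => lab x.1) =
      insert (lab h) J := by
  ext i
  simp only [Finset.mem_image, Finset.mem_univ, true_and, Finset.mem_insert]
  constructor
  · rintro ⟨⟨x, hx | hx⟩, rfl⟩
    · exact Or.inl ((hl h x).2 (sameCycle_of_swap_mul hs hx)).symm
    · exact Or.inr hx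
  · rintro (rfl | hi)
    · exact ⟨⟨h, side_left J⟩, rfl⟩
    · obtain ⟨x, -, rfl⟩ := Finset.mem_image.1 (Finset.mem_of_mem_erase (hJ hi))
      exact ⟨⟨x, Or.inr hi⟩, rfl⟩

theorem image_not_side (hl : IsLabelling σ lab) (hhk : h ≠ k) (hs : SameCycle σ h k)
    {J : Finset L} (hJ : lab h ∉ J) [Fintype {x // ¬ side (swap h k * σ) lab h J x}] :
    (Finset.univ.image fun x : {x // ¬ side (swap h k * σ) lab h J x} => lab x.1) =
      insert (lab h) ((Finset.univ.image lab).erase (lab h) \ J) := by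
  ext i
  simp only [Finset.mem_image, Finset.mem_univ, true_and, Finset.mem_insert, Finset.mem_sdiff,
    Finset.mem_erase]
  constructor
  · rintro ⟨⟨x, hx⟩, rfl⟩
    by_cases hxh : lab x = lab h
    · exact Or.inl hxh
    · exact Or.inr ⟨⟨hxh, x, rfl⟩, fun hc => hx (Or.inr hc)⟩
  · rintro (rfl | ⟨⟨hi, x, rfl⟩, hiJ⟩)
    · exact ⟨⟨k, not_side_right hl hhk hs hJ⟩, ((hl h k).2 hs).symm⟩
    · refine ⟨⟨x, ?_⟩, rfl⟩
      rintro (hx | hx)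
      · exact hi ((hl h x).2 (sameCycle_of_swap_mul hs hx)).symm
      · exact hiJ hx

open Classical in
theorem deg_side (hl : IsLabelling σ lab) (hhk : h ≠ k) (hh : h ∈ S) (hk : k ∈ S)
    (hs : SameCycle σ h k) {J : Finset L} (hJ : lab h ∉ J) {i : L} (hi : i ∈ insert (lab h) J) :
    deg (fun x : {x // side (swap h k * σ) lab h J x} => lab x.1)
        (((S.erase h).erase k).subtype (side (swap h k * σ) lab h J)) i =
      Function.update (deg lab S) (lab h)
        (((S.erase h).erase k).filter (SameCycle (swap h k * σ) h)).card i := by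
  have hlk : lab k = lab h := ((hl h k).2 hs).symm
  rw [deg_subtype]
  rcases Finset.mem_insert.1 hi with rfl | hi
  · rw [Function.update_self]
    congr 1
    ext x
    simp only [Finset.mem_filter, side]
    constructor
    · rintro ⟨⟨h1, h2⟩, h3 | h3⟩
      · exact ⟨h1, h3⟩
      · exact absurd (h2 ▸ h3) hJ
    · rintro ⟨h1, h2⟩
      exact ⟨⟨h1, ((hl h x).2 (sameCycle_of_swap_mul hs h2)).symm⟩, Or.inl h2⟩
  · have hne : i ≠ lab h := fun hc => hJ (hc ▸ hi)
    rw [Function.update_of_ne hne, Finset.filter_true_of_mem]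
    · change deg lab _ i = _
      rw [deg_erase_erase hhk hh hk, hlk, if_neg hne.symm]; rfl
    · intro x hx
      rw [Finset.mem_filter] at hx
      exact Or.inr (hx.2 ▸ hi)

open Classical in
theorem deg_not_side (hl : IsLabelling σ lab) (hhk : h ≠ k) (hh : h ∈ S) (hk : k ∈ S)
    (hs : SameCycle σ h k) {J : Finset L} (hJ : lab h ∉ J) {i : L} (hi : i ∉ J) :
    deg (fun x : {x // ¬ side (swap h k * σ) lab h J x} => lab x.1)
        (((S.erase h).erase k).subtype fun x => ¬ side (swap h k * σ) lab h J x) i =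
      Function.update (deg lab S) (lab h) (deg lab S (lab h) - 2 -
        (((S.erase h).erase k).filter (SameCycle (swap h k * σ) h)).card) i := by
  have hlk : lab k = lab h := ((hl h k).2 hs).symm
  have hd := deg_erase_erase (lab := lab) hhk hh hk i
  rw [deg_subtype]
  by_cases hne : i = lab h
  · subst hne
    rw [Function.update_self]
    have h1 := deg_side hl hhk hh hk hs hJ (Finset.mem_insert_self _ J)
    rw [deg_subtype, Function.update_self] at h1
    have h2 := Finset.card_filter_add_card_filter_not
      (s := ((S.erase h).erase k).filter fun x => lab x = lab h)
      (side (swap h k * σ) lab h J)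
    rw [hlk, if_pos rfl, deg] at hd
    omega
  · rw [Function.update_of_ne hne, Finset.filter_true_of_mem]
    · change deg lab _ i = _
      rw [hd, hlk, if_neg (Ne.symm hne)]; rfl
    · intro x hx
      rw [Finset.mem_filter] at hx
      rintro (h3 | h3)
      · exact hne (hx.2.symm.trans ((hl h x).2 (sameCycle_of_swap_mul hs h3)).symm)
      · exact hi (hx.2 ▸ h3)

end Step

/-- The number of connected planar gluings is the solution of the planar recursion. The proof
contracts the edge at some `h ∈ S`, so `S` loses two points and `H` either stays the same or is
replaced by the two sides of a loop. -/
theorem gluingCount_eq [DecidableEq L] {cc : Finset L → (L → ℕ) → ℚ} (hcc : PlanarRecursion cc)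
    [Fintype H] [Nonempty H] {σ : Perm H} {lab : H → L} (hl : IsLabelling σ lab) (S : Finset H) :
    (gluingCount σ S : ℚ) = cc (Finset.univ.image lab) (deg lab S) := by
  classical
  induction hn : S.card using Nat.strong_induction_on generalizing H with
  | _ n ih =>
    subst hn
    rcases S.eq_empty_or_nonempty with rfl | ⟨h, hh⟩
    · rw [gluingCount_empty hl, hcc.base _ _ (Finset.univ_nonempty.image lab)
        (fun i _ => by simp [deg])]
      push_cast
      rfl
    set I := Finset.univ.image lab with hI
    set d := deg lab S with hd
    have hfib : gluingCount σ S =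
        ∑ k ∈ S.erase h, Nat.card {α // IsPlanarGluing σ S α ∧ α h = k} := by
      refine card_subtype_eq_sum (fun α => ⟨fun hα => ⟨α h, ?_, hα, rfl⟩, ?_⟩) ?_
      · exact Finset.mem_erase.2 ⟨(hα.1.2 h).2 hh, hα.1.apply_mem hh⟩
      · rintro ⟨k, -, hα, -⟩
        exact hα
      · rintro k - k' - α ⟨-, h1⟩ ⟨-, h2⟩
        exact h1.symm.trans h2
    have hpos : 1 ≤ d (lab h) := Finset.card_pos.2 ⟨h, Finset.mem_filter.2 ⟨hh, rfl⟩⟩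
    rw [hfib, hcc.step I d (lab h) (by simp [hI]) hpos, ← Finset.sum_filter_add_sum_filter_not
      (S.erase h) (SameCycle σ h), add_comm]
    push_cast
    congr 1
    · -- edges from `h` to another vertex
      have hmaps : ∀ k ∈ (S.erase h).filter (fun k => ¬ SameCycle σ h k),
          lab k ∈ I.erase (lab h) := by
        intro k hk
        rw [Finset.mem_filter] at hk
        exact Finset.mem_erase.2 ⟨fun hc => hk.2 ((hl h k).1 hc.symm), by simp [hI]⟩
      rw [← Finset.sum_fiberwise_of_maps_to hmaps]
      refine Finset.sum_congr rfl fun j hj => ?_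
      have hj' := Finset.ne_of_mem_erase hj
      have hfilter : ((S.erase h).filter (fun k => ¬ SameCycle σ h k)).filter (fun k => lab k = j) =
          S.filter fun k => lab k = j := by
        ext k
        simp only [Finset.mem_filter, Finset.mem_erase]
        constructor
        · rintro ⟨⟨⟨-, h1⟩, -⟩, h2⟩
          exact ⟨h1, h2⟩
        · rintro ⟨h1, h2⟩
          refine ⟨⟨⟨?_, h1⟩, fun hc => ?_⟩, h2⟩
          · rintro rfl
            exact hj' h2.symm
          · exact hj' (h2.symm.trans ((hl h k).2 hc).symm)
      rw [hfilter]
      have hterm : ∀ k ∈ S.filter (fun k => lab k = j),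
          (Nat.card {α // IsPlanarGluing σ S α ∧ α h = k} : ℚ) =
            cc (I.erase j) (Function.update d (lab h) (d (lab h) + d j - 2)) := by
        intro k hk
        obtain ⟨hkS, rfl⟩ := Finset.mem_filter.1 hk
        have hs : ¬ SameCycle σ h k := fun hc => hj' ((hl h k).2 hc).symm
        have hhk : h ≠ k := fun hc => hs (hc ▸ SameCycle.refl σ h)
        have hc := card_erase_erase hhk hh hkS
        rw [card_gluing_of_not_sameCycle hh hkS hs,
          ih _ (by omega) (isLabelling_mergeLab hl hs) _ rfl, image_mergeLab hj'.symm]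
        refine hcc.congr _ _ _ fun i hi => ?_
        exact deg_mergeLab hj'.symm hh hkS (Finset.ne_of_mem_erase hi)
      rw [Finset.sum_congr rfl hterm, Finset.sum_const, nsmul_eq_mul]
      rfl
    · -- loops at the vertex of `h`
      have hfilter : (S.filter (SameCycle σ h)).card = d (lab h) := by
        rw [hd, deg]
        congr 1
        ext x
        rw [Finset.mem_filter, Finset.mem_filter, ← hl h x, @eq_comm _ (lab h)]
      have harc := sum_arc (σ := σ) hh fun a => ∑ J ∈ (I.erase (lab h)).powerset,
        cc (insert (lab h) J) (Function.update d (lab h) a) *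
          cc (insert (lab h) (I.erase (lab h) \ J))
            (Function.update d (lab h) (d (lab h) - 2 - a))
      rw [hfilter] at harc
      rw [← harc]
      refine Finset.sum_congr rfl fun k hk => ?_
      obtain ⟨hk, hs⟩ := Finset.mem_filter.1 hk
      obtain ⟨hkh, hk⟩ := Finset.mem_erase.1 hk
      have hc := card_erase_erase hkh.symm hh hk
      rw [card_gluing_loop hl hkh.symm hh hk hs]
      push_cast
      refine Finset.sum_congr rfl fun J hJ => ?_
      have hJ := Finset.mem_powerset.1 hJ
      have hJ' : lab h ∉ J := fun hc => Finset.notMem_erase _ _ (hJ hc)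
      have hnk := not_side_right hl hkh.symm hs hJ'
      rw [card_isSplitGluing (side_apply_iff hl hs J)
        (fun x => not_congr (side_apply_iff hl hs J x)) ⟨h, side_left J⟩ ⟨k, hnk⟩]
      push_cast
      have : Nonempty {x // side (swap h k * σ) lab h J x} := ⟨⟨h, side_left J⟩⟩
      have : Nonempty {x // ¬ side (swap h k * σ) lab h J x} := ⟨⟨k, hnk⟩⟩
      have hle1 : (((S.erase h).erase k).subtype (side (swap h k * σ) lab h J)).card < S.card := by
        rw [Finset.card_subtype]
        have := Finset.card_filter_le ((S.erase h).erase k) (side (swap h k * σ) lab h J)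
        omega
      have hle2 : (((S.erase h).erase k).subtype
          fun x => ¬ side (swap h k * σ) lab h J x).card < S.card := by
        rw [Finset.card_subtype]
        have := Finset.card_filter_le ((S.erase h).erase k)
          (fun x => ¬ side (swap h k * σ) lab h J x)
        omega
      rw [ih _ hle1 (isLabelling_side hl hs hJ') _ rfl,
        ih _ hle2 (isLabelling_not_side hl hs J) _ rfl, image_side hl hs hJ,
        image_not_side hl hkh.symm hs hJ']
      congr 1
      · exact hcc.congr _ _ _ fun i hi => deg_side hl hkh.symm hh hk hs hJ' hi
      · refine hcc.congr _ _ _ fun i hi => deg_not_side hl hkh.symm hh hk hs hJ' ?_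
        rcases Finset.mem_insert.1 hi with rfl | hi
        · exact hJ'
        · exact (Finset.mem_sdiff.1 hi).2

end PlanarCount

/-! ### The solution with at most three vertices -/

namespace PlanarCount

/-- The closed formula for the number of connected planar gluings with at most three vertices. Its
values for larger `I` are irrelevant. -/
def planarFormula {L : Type} (I : Finset L) (d : L → ℕ) : ℚ :=
  if I.card = 1 then disc (∑ i ∈ I, d i)
  else if ¬ Even (∑ i ∈ I, d i) then 0
  else if I.card = 2 then 2 * (∏ i ∈ I, weight (d i)) / ((∑ i ∈ I, d i : ℕ) : ℚ)
  else ∏ i ∈ I, weight (d i)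

section

variable {L : Type}

theorem planarFormula_one (i : L) (d : L → ℕ) : planarFormula {i} d = disc (d i) := by
  simp [planarFormula]

variable [DecidableEq L]

theorem planarFormula_two {i j : L} (hij : i ≠ j) (d : L → ℕ) :
    planarFormula {i, j} d = annulus (d i) (d j) := by
  have hc : ({i, j} : Finset L).card = 2 := Finset.card_pair hij
  rw [planarFormula, hc, if_neg (by norm_num), Finset.sum_pair hij, Finset.prod_pair hij,
    if_pos (c := 2 = 2) rfl, ite_not, annulus, mul_assoc]
  push_cast
  rfl

theorem planarFormula_three {i j l : L} (hij : i ≠ j) (hil : i ≠ l) (hjl : j ≠ l) (d : L → ℕ) :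
    planarFormula {i, j, l} d = pants (d i) (d j) (d l) := by
  have hi : i ∉ ({j, l} : Finset L) := by simp [hij, hil]
  have hc : ({i, j, l} : Finset L).card = 3 := by
    rw [Finset.card_insert_of_notMem hi, Finset.card_pair hjl]
  rw [planarFormula, hc, if_neg (by norm_num), if_neg (c := 3 = 2) (by norm_num),
    Finset.sum_insert hi, Finset.prod_insert hi, Finset.sum_pair hjl, Finset.prod_pair hjl, pants,
    ← add_assoc, ← mul_assoc]
  split_ifs with h1
  · rfl
  · rfl

theorem sum_range_reflect_two {M : Type*} [AddCommMonoid M] (f : ℕ → ℕ → M) (n : ℕ) :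
    ∑ a ∈ Finset.range (n - 1), f a (n - 2 - a) = ∑ a ∈ Finset.range (n - 1), f (n - 2 - a) a := by
  rw [← Finset.sum_range_reflect]
  refine Finset.sum_congr rfl fun a ha => ?_
  have := Finset.mem_range.1 ha
  rw [show n - 1 - 1 - a = n - 2 - a by omega, show n - 2 - (n - 2 - a) = a by omega]

end

/-- The closed formula satisfies the planar recursion. -/
theorem planarRecursion_planarFormula {L : Type} [Fintype L] [DecidableEq L]
    (hL : Fintype.card L ≤ 3) : PlanarRecursion (planarFormula (L := L)) where
  congr I d d' h := by
    rw [planarFormula, planarFormula, Finset.sum_congr rfl h,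
      Finset.prod_congr rfl fun i hi => congrArg weight (h i hi)]
  base I d hne h := by
    have h0 : ∑ i ∈ I, d i = 0 := Finset.sum_eq_zero h
    rw [planarFormula, h0]
    obtain ⟨i, hi⟩ := hne
    have hp : ∏ i ∈ I, weight (d i) = 0 :=
      Finset.prod_eq_zero hi (by rw [h i hi, weight_zero])
    rw [hp]
    simp [disc_zero]
  step I d i hi hd := by
    obtain ⟨K, hiK, rfl⟩ : ∃ K, i ∉ K ∧ insert i K = I :=
      ⟨I.erase i, Finset.notMem_erase i I, Finset.insert_erase hi⟩
    have hcard : K.card ≤ 2 := by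
      have h1 := Finset.card_le_univ (insert i K)
      rw [Finset.card_insert_of_notMem hiK] at h1
      omega
    rw [Finset.erase_insert hiK]
    have hcases : K.card = 0 ∨ K.card = 1 ∨ K.card = 2 := by omega
    rcases hcases with hK | hK | hK
    · obtain rfl := Finset.card_eq_zero.1 hK
      simp only [Finset.sum_empty, Finset.powerset_empty, Finset.sum_singleton,
        Finset.sdiff_self, insert_empty_eq, planarFormula_one, Function.update_self, zero_add]
      exact disc_rec hd
    · obtain ⟨j, rfl⟩ := Finset.card_eq_one.1 hK
      have hij : i ≠ j := fun hc => hiK (by simp [hc])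
      have e1 : (insert i {j} : Finset L).erase j = {i} := by ext x; simp; grind
      have e2 : ({j} : Finset L).powerset = {∅, {j}} := by
        rw [show ({j} : Finset L) = insert j ∅ from rfl, Finset.powerset_insert]; rfl
      rw [Finset.sum_singleton, e1, e2]
      simp only [Finset.sum_pair (Finset.singleton_ne_empty j).symm, Finset.sdiff_empty,
        Finset.sdiff_self, insert_empty_eq, planarFormula_one, planarFormula_two hij,
        Function.update_self, Function.update_of_ne hij.symm]
      rw [Finset.sum_add_distrib, sum_range_reflect_two (fun a b => annulus a (d j) * disc b),
        annulus_rec hd]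
      simp only [mul_comm (annulus _ _) (disc _)]
      ring
    · obtain ⟨j, l, hjl, rfl⟩ := Finset.card_eq_two.1 hK
      have hij : i ≠ j := fun hc => hiK (by simp [hc])
      have hil : i ≠ l := fun hc => hiK (by simp [hc])
      have e1 : (insert i {j, l} : Finset L).erase j = {i, l} := by ext x; simp; grind
      have e1' : (insert i {j, l} : Finset L).erase l = {i, j} := by ext x; simp; grind
      have e2 : ∀ f : Finset L → ℚ, ∑ J ∈ ({j, l} : Finset L).powerset, f J =
          f ∅ + f {l} + (f {j} + f {j, l}) := by
        intro f
        rw [Finset.sum_powerset_insert (by simpa using hjl),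
          show ({l} : Finset L) = insert l ∅ from rfl, Finset.sum_powerset_insert (by simp),
          Finset.sum_powerset_insert (by simp)]
        simp
      have e3 : ({j, l} : Finset L) \ {j} = {l} := by ext x; simp; grind
      have e4 : ({j, l} : Finset L) \ {l} = {j} := by ext x; simp; grind
      rw [Finset.sum_pair hjl, e1, e1']
      simp only [e2, e3, e4, Finset.sdiff_empty, Finset.sdiff_self, insert_empty_eq,
        planarFormula_one, planarFormula_two hij, planarFormula_two hil,
        planarFormula_three hij hil hjl,
        Function.update_self, Function.update_of_ne hij.symm, Function.update_of_ne hil.symm]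
      simp only [Finset.sum_add_distrib]
      rw [sum_range_reflect_two (fun a b => annulus a (d l) * annulus b (d j)),
        sum_range_reflect_two (fun a b => pants a (d j) (d l) * disc b), pants_rec hd]
      simp only [Finset.sum_add_distrib, mul_comm (pants _ _ _) (disc _),
        mul_comm (annulus _ (d l)) (annulus _ (d j))]
      ring

end PlanarCount

/-! ### From marked graphs to gluings of a fixed collection of vertices -/

namespace PlanarCount

open Equiv Equiv.Perm

section Transfer

variable {H H' : Type}

theorem sameCycle_iff_of_intertwine {π : Perm H} {π' : Perm H'} (ψ : H ≃ H')
    (h : ∀ x, π' (ψ x) = ψ (π x)) (x y : H) : SC π x y ↔ SC π' (ψ x) (ψ y) := by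
  constructor
  · have : SC π ≤ (SC π').comap ψ := SC_le_iff.2 fun x => by
      rw [Setoid.comap_rel, ← h]
      exact SC_le_iff.1 le_rfl (ψ x)
    exact fun hxy => this hxy
  · have : SC π' ≤ (SC π).comap ψ.symm := SC_le_iff.2 fun x => by
      obtain ⟨x, rfl⟩ := ψ.surjective x
      rw [Setoid.comap_rel, h, ψ.symm_apply_apply, ψ.symm_apply_apply]
      exact SC_le_iff.1 le_rfl x
    intro hxy
    simpa [Setoid.comap_rel] using this hxy

theorem cycles_eq_of_intertwine {π : Perm H} {π' : Perm H'} (ψ : H ≃ H')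
    (h : ∀ x, π' (ψ x) = ψ (π x)) : cycles π = cycles π' :=
  Nat.card_congr (Quotient.congr ψ (sameCycle_iff_of_intertwine ψ h))

theorem orbitRel_of_intertwine {σ α : Perm H} {σ' α' : Perm H'} (ψ : H ≃ H')
    (hσ : ∀ x, σ' (ψ x) = ψ (σ x)) (hα : ∀ x, α' (ψ x) = ψ (α x))
    (h : ∀ x y, orbitRel σ α x y) (x y : H') : orbitRel σ' α' x y := by
  have : orbitRel σ α ≤ (orbitRel σ' α').comap ψ := orbitRel_le_iff.2
    ⟨fun x => by rw [Setoid.comap_rel, ← hσ]; exact orbitRel_left _ _ _,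
     fun x => by rw [Setoid.comap_rel, ← hα]; exact orbitRel_right _ _ _⟩
  obtain ⟨x, rfl⟩ := ψ.surjective x
  obtain ⟨y, rfl⟩ := ψ.surjective y
  exact this (h x y)

theorem intertwine_symm {π : Perm H} {π' : Perm H'} (ψ : H ≃ H')
    (h : ∀ x, π' (ψ x) = ψ (π x)) (x : H') : π (ψ.symm x) = ψ.symm (π' x) := by
  rw [Equiv.eq_symm_apply, ← h, ψ.apply_symm_apply]

theorem intertwine_inv_mul {σ α : Perm H} {σ' α' : Perm H'} (ψ : H ≃ H')
    (hσ : ∀ x, σ' (ψ x) = ψ (σ x)) (hα : ∀ x, α' (ψ x) = ψ (α x)) (x : H) :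
    (σ'⁻¹ * α') (ψ x) = ψ ((σ⁻¹ * α) x) := by
  rw [mul_apply, mul_apply, inv_eq_iff_eq, hα, hσ, ← mul_apply σ, mul_inv_cancel, one_apply]

theorem isPretransitive_closure_iff {σ α : Perm H} :
    MulAction.IsPretransitive (Subgroup.closure {α, σ}) H ↔ ∀ x y, orbitRel σ α x y := by
  constructor
  · intro hp x y
    obtain ⟨⟨g, hg⟩, rfl⟩ := hp.exists_smul_eq x y
    change orbitRel σ α x (g x)
    clear hp
    induction hg using Subgroup.closure_induction generalizing x with
    | mem g hg =>
      rcases hg with rfl | rfl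
      · exact orbitRel_right _ _ _
      · exact orbitRel_left _ _ _
    | one => exact (orbitRel σ α).refl x
    | mul a b _ _ ha hb => exact (orbitRel σ α).trans (hb x) (ha (b x))
    | inv a _ ha =>
      have := ha (a⁻¹ x)
      rw [← mul_apply, mul_inv_cancel, one_apply] at this
      exact (orbitRel σ α).symm this
  · intro h
    refine ⟨fun x y => ?_⟩
    have hle : orbitRel σ α ≤ MulAction.orbitRel (Subgroup.closure {α, σ}) H := by
      refine orbitRel_le_iff.2 ⟨fun x => ?_, fun x => ?_⟩
      · refine (MulAction.orbitRel _ H).symm ?_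
        exact ⟨⟨σ, Subgroup.subset_closure (by simp)⟩, rfl⟩
      · refine (MulAction.orbitRel _ H).symm ?_
        exact ⟨⟨α, Subgroup.subset_closure (by simp)⟩, rfl⟩
    have h1 : MulAction.orbitRel (Subgroup.closure {α, σ}) H y x := hle (h y x)
    exact h1

end Transfer

section Model

variable {n : ℕ} (μ : Fin n → ℕ)

/-- The half-edges of the standard vertices with degrees `μ`. -/
abbrev StdHalfEdge : Type := Σ i : Fin n, ZMod (μ i)

/-- The rotation of the standard vertices: `σ (i, t) = (i, t + 1)`. -/
def stdRotation : Perm (StdHalfEdge μ) := Equiv.sigmaCongrRight fun _ => Equiv.addRight 1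

variable {μ}

theorem stdRotation_apply (i : Fin n) (t : ZMod (μ i)) :
    stdRotation μ ⟨i, t⟩ = ⟨i, t + 1⟩ := rfl

theorem stdRotation_pow_apply (i : Fin n) (t : ZMod (μ i)) (m : ℕ) :
    (stdRotation μ ^ m) ⟨i, t⟩ = ⟨i, t + m⟩ := by
  induction m with
  | zero => simp
  | succ m ih => rw [pow_succ', mul_apply, ih, stdRotation_apply, Nat.cast_succ, add_assoc]

variable [∀ i, NeZero (μ i)]

theorem isLabelling_stdRotation : IsLabelling (stdRotation μ) Sigma.fst := by
  rintro ⟨i, s⟩ ⟨j, t⟩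
  constructor
  · rintro (rfl : i = j)
    refine ⟨((t - s).val : ℤ), ?_⟩
    rw [zpow_natCast, stdRotation_pow_apply, ZMod.natCast_zmod_val, add_sub_cancel]
  · intro h
    obtain ⟨m, hm⟩ := h.exists_nat_pow_eq
    rw [stdRotation_pow_apply] at hm
    have h1 := congrArg Sigma.fst hm
    exact h1

theorem deg_stdRotation (i : Fin n) :
    deg Sigma.fst (Finset.univ : Finset (StdHalfEdge μ)) i = μ i := by
  rw [deg, ← Fintype.card_subtype]
  have e : {x : StdHalfEdge μ // x.1 = i} ≃ ZMod (μ i) := Equiv.sigmaSubtype i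
  rw [Fintype.card_congr e, ZMod.card]

theorem image_fst : (Finset.univ : Finset (StdHalfEdge μ)).image Sigma.fst = Finset.univ := by
  ext i
  simp only [Finset.mem_image, Finset.mem_univ, true_and, iff_true]
  exact ⟨⟨i, 0⟩, rfl⟩

end Model

section Realize

variable {n e : ℕ} {μ : Fin n → ℕ}

/-- A bijection from the standard half-edges to those of `Γ` that is compatible with the rotation
and the labels at the vertices. -/
def IsFrame (Γ : MarkedGraph e n) (ψ : StdHalfEdge μ ≃ Fin (2 * e)) : Prop :=
  (∀ x, Γ.σ (ψ x) = ψ (stdRotation μ x)) ∧ ∀ x, Γ.label (ψ x) = x.1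

/-- `Γ` is isomorphic to the marked graph given by the gluing `α` of the standard vertices. -/
def Realizes (Γ : MarkedGraph e n) (α : Perm (StdHalfEdge μ)) : Prop :=
  ∃ ψ, IsFrame Γ ψ ∧ ∀ x, Γ.α (ψ x) = ψ (α x)

theorem label_eq_iff (Γ : MarkedGraph e n) (x y : Fin (2 * e)) :
    Γ.label x = Γ.label y ↔ SameCycle Γ.σ x y := by
  rw [MarkedGraph.label, MarkedGraph.label, Γ.mark.injective.eq_iff]
  exact Quotient.eq (r := SameCycle.setoid Γ.σ)

theorem label_pow (Γ : MarkedGraph e n) (m : ℕ) (x : Fin (2 * e)) :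
    Γ.label ((Γ.σ ^ m) x) = Γ.label x :=
  ((label_eq_iff Γ _ _).2 (sameCycle_pow_right.2 (SameCycle.refl _ x))).symm

theorem minimalPeriod_eq_degree (Γ : MarkedGraph e n) (x : Fin (2 * e)) :
    Function.minimalPeriod Γ.σ x = Γ.degree (Γ.label x) := by
  rw [MarkedGraph.degree, ← Nat.card_fin (Function.minimalPeriod Γ.σ x)]
  refine Nat.card_congr (Equiv.ofBijective
    (fun i : Fin (Function.minimalPeriod Γ.σ x) => ⟨(Γ.σ ^ i.1) x, label_pow Γ i.1 x⟩) ⟨?_, ?_⟩)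
  · intro i j hij
    exact Fin.ext (pow_injOn_minimalPeriod i.2 j.2 (congrArg Subtype.val hij))
  · rintro ⟨y, hy⟩
    obtain ⟨i, hi, rfl⟩ := sameCycle_iff_exists_lt.1 ((label_eq_iff Γ x y).1 hy.symm)
    exact ⟨⟨i, hi⟩, rfl⟩

theorem Realizes.of_iso {Γ Γ' : MarkedGraph e n} {φ : Perm (Fin (2 * e))}
    (hφ : MarkedGraph.IsMarkedIso Γ Γ' φ) {α : Perm (StdHalfEdge μ)} (h : Realizes Γ α) :
    Realizes Γ' α := by
  obtain ⟨ψ, ⟨h1, h2⟩, h3⟩ := h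
  obtain ⟨k1, k2, k3⟩ := hφ
  refine ⟨ψ.trans φ, ⟨fun x => ?_, fun x => ?_⟩, fun x => ?_⟩
  · have := Equiv.congr_fun k2 (ψ x)
    simpa [h1] using this
  · have := k3 (ψ x)
    simpa [h2] using this
  · have := Equiv.congr_fun k1 (ψ x)
    simpa [h3] using this

theorem exists_iso_of_realizes {Γ Γ' : MarkedGraph e n} {α : Perm (StdHalfEdge μ)}
    (h : Realizes Γ α) (h' : Realizes Γ' α) : ∃ φ, MarkedGraph.IsMarkedIso Γ Γ' φ := by
  obtain ⟨ψ, ⟨h1, h2⟩, h3⟩ := h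
  obtain ⟨ψ', ⟨k1, k2⟩, k3⟩ := h'
  refine ⟨ψ.symm.trans ψ', Equiv.ext fun x => ?_, Equiv.ext fun x => ?_, fun x => ?_⟩
  · obtain ⟨x, rfl⟩ := ψ.surjective x
    simp [h3, k3]
  · obtain ⟨x, rfl⟩ := ψ.surjective x
    simp [h1, k1]
  · obtain ⟨x, rfl⟩ := ψ.surjective x
    simp [h2, k2]

variable [∀ i, NeZero (μ i)]

/-- A frame is determined by the half-edges that serve as base points of the vertices, and these
can be chosen freely. -/
theorem card_frames (Γ : MarkedGraph e n) (hμ : ∀ i, Γ.degree i = μ i) :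
    Nat.card {ψ : StdHalfEdge μ ≃ Fin (2 * e) // IsFrame Γ ψ} = ∏ i, μ i := by
  have hfr : ∀ (ψ : StdHalfEdge μ ≃ Fin (2 * e)), IsFrame Γ ψ → ∀ i (t : ZMod (μ i)),
      ψ ⟨i, t⟩ = (Γ.σ ^ t.val) (ψ ⟨i, 0⟩) := by
    intro ψ hψ i t
    have key : ∀ m : ℕ, (Γ.σ ^ m) (ψ ⟨i, 0⟩) = ψ ⟨i, (m : ZMod (μ i))⟩ := by
      intro m
      induction m with
      | zero => simp
      | succ m ih => rw [pow_succ', mul_apply, ih, hψ.1, stdRotation_apply, Nat.cast_succ]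
    rw [key, ZMod.natCast_zmod_val]
  let f : {ψ : StdHalfEdge μ ≃ Fin (2 * e) // IsFrame Γ ψ} →
      ∀ i, {h : Fin (2 * e) // Γ.label h = i} := fun ψ i => ⟨ψ.1 ⟨i, 0⟩, ψ.2.2 ⟨i, 0⟩⟩
  have hf : Function.Bijective f := by
    constructor
    · rintro ⟨ψ, hψ⟩ ⟨ψ', hψ'⟩ h
      refine Subtype.ext (Equiv.ext ?_)
      rintro ⟨i, t⟩
      have : ψ ⟨i, 0⟩ = ψ' ⟨i, 0⟩ := congrArg Subtype.val (congrFun h i)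
      change ψ ⟨i, t⟩ = ψ' ⟨i, t⟩
      rw [hfr ψ hψ, hfr ψ' hψ', this]
    · intro r
      have hper : ∀ i, Function.minimalPeriod Γ.σ (r i).1 = μ i := fun i => by
        rw [minimalPeriod_eq_degree, (r i).2, hμ]
      have hinj : Function.Injective fun x : StdHalfEdge μ => (Γ.σ ^ x.2.val) (r x.1).1 := by
        rintro ⟨i, s⟩ ⟨j, t⟩ h
        have hij : i = j := by
          have := congrArg Γ.label h
          simpa [label_pow, (r _).2] using this
        subst hij
        have := pow_injOn_minimalPeriod (by rw [hper]; exact s.val_lt)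
          (by rw [hper]; exact t.val_lt) h
        have hst : s = t := ZMod.val_injective _ this
        rw [hst]
      have hcard : Fintype.card (StdHalfEdge μ) = Fintype.card (Fin (2 * e)) := by
        rw [Fintype.card_sigma, Fintype.card_fin, ← Γ.sum_degree]
        exact Finset.sum_congr rfl fun i _ => by rw [ZMod.card, hμ]
      let ψ := Equiv.ofBijective _ ((Fintype.bijective_iff_injective_and_card _).2 ⟨hinj, hcard⟩)
      refine ⟨⟨ψ, ?_, ?_⟩, ?_⟩
      · rintro ⟨i, t⟩
        change Γ.σ ((Γ.σ ^ t.val) (r i).1) = (Γ.σ ^ (t + 1).val) (r i).1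
        have h1 : (t + 1).val = (t.val + 1) % μ i := by
          rw [← ZMod.val_natCast, Nat.cast_succ, ZMod.natCast_zmod_val]
        have h2 : (Γ.σ ^ μ i) (r i).1 = (r i).1 := by
          rw [← hper i]; exact pow_minimalPeriod_apply _ _
        rw [h1, pow_mod_apply h2, pow_succ', mul_apply]
      · rintro ⟨i, t⟩
        exact (label_pow Γ _ _).trans (r i).2
      · funext i
        refine Subtype.ext ?_
        change (Γ.σ ^ (0 : ZMod (μ i)).val) (r i).1 = (r i).1
        rw [ZMod.val_zero, pow_zero, one_apply]
  rw [Nat.card_congr (Equiv.ofBijective f hf), Nat.card_pi]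
  exact Finset.prod_congr rfl fun i _ => hμ i

/-- The frames of `Γ` inducing a given gluing form a torsor under the automorphism group. -/
theorem card_realizes_mul_card_autV (Γ : MarkedGraph e n) (hμ : ∀ i, Γ.degree i = μ i) :
    Nat.card {α : Perm (StdHalfEdge μ) // Realizes Γ α} * Nat.card Γ.autV = ∏ i, μ i := by
  rw [← card_frames Γ hμ]
  let f : {ψ : StdHalfEdge μ ≃ Fin (2 * e) // IsFrame Γ ψ} →
      {α : Perm (StdHalfEdge μ) // Realizes Γ α} := fun ψ =>
    ⟨(ψ.1.trans Γ.α).trans ψ.1.symm, ψ.1, ψ.2, fun x => by simp⟩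
  have := Fintype.ofFinite {α : Perm (StdHalfEdge μ) // Realizes Γ α}
  rw [← Nat.card_congr (Equiv.sigmaFiberEquiv f), Nat.card_sigma]
  have hfib : ∀ a, Nat.card {ψ // f ψ = a} = Nat.card Γ.autV := by
    rintro ⟨α, ψ₀, hψ₀, hα⟩
    have hf : ∀ ψ, f ψ = ⟨α, ψ₀, hψ₀, hα⟩ ↔ ∀ x, Γ.α (ψ.1 x) = ψ.1 (α x) := by
      intro ψ
      rw [Subtype.ext_iff, Equiv.ext_iff]
      refine forall_congr' fun x => ?_
      change ψ.1.symm (Γ.α (ψ.1 x)) = α x ↔ _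
      rw [Equiv.symm_apply_eq]
    refine Nat.card_congr
      ⟨fun ψ => ⟨ψ₀.symm.trans ψ.1.1, ?_⟩,
       fun φ => ⟨⟨ψ₀.trans φ.1, ?_, ?_⟩, (hf _).2 ?_⟩, ?_, ?_⟩
    · have h1 := (hf ψ.1).1 ψ.2
      refine ⟨Equiv.ext fun x => ?_, Equiv.ext fun x => ?_, fun x => ?_⟩
      · obtain ⟨x, rfl⟩ := ψ₀.surjective x
        simp [h1, hα]
      · obtain ⟨x, rfl⟩ := ψ₀.surjective x
        simp [ψ.1.2.1, hψ₀.1]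
      · obtain ⟨x, rfl⟩ := ψ₀.surjective x
        simp [ψ.1.2.2, hψ₀.2]
    · intro x
      have h2 := Equiv.congr_fun φ.2.2.1 (ψ₀ x)
      simpa [hψ₀.1] using h2
    · intro x
      have h2 := φ.2.2.2 (ψ₀ x)
      simpa [hψ₀.2] using h2
    · intro x
      have h2 := Equiv.congr_fun φ.2.1 (ψ₀ x)
      simpa [hα] using h2
    · intro ψ
      refine Subtype.ext (Subtype.ext (Equiv.ext fun x => ?_))
      simp
    · intro φ
      refine Subtype.ext (Equiv.ext fun x => ?_)
      simp
  simp only [hfib]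
  rw [Finset.sum_const, smul_eq_mul, Finset.card_univ, Nat.card_eq_fintype_card]

theorem Realizes.isPlanarGluing {Γ : MarkedGraph e n} (hg : Γ.HasGenus 0)
    {α : Perm (StdHalfEdge μ)} (h : Realizes Γ α) :
    IsPlanarGluing (stdRotation μ) Finset.univ α := by
  obtain ⟨ψ, ⟨h1, -⟩, h3⟩ := h
  have hcard : Fintype.card (StdHalfEdge μ) = 2 * e := by
    rw [Fintype.card_congr ψ, Fintype.card_fin]
  refine ⟨⟨fun x => ψ.injective ?_, fun x => ?_⟩, ?_, ?_⟩
  · rw [← h3, ← h3, Γ.α_involutive]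
  · simp only [Finset.mem_univ, iff_true]
    intro hc
    exact Γ.α_no_fixed_point (ψ x) (by rw [h3, hc])
  · exact orbitRel_of_intertwine ψ.symm (intertwine_symm ψ h1) (intertwine_symm ψ h3)
      (isPretransitive_closure_iff.1 Γ.transitive)
  · have hV := cycles_eq_of_intertwine ψ h1
    have hF := cycles_eq_of_intertwine ψ (intertwine_inv_mul ψ h1 h3)
    have hg' : (cycles Γ.σ : ℤ) - e + cycles (Γ.σ⁻¹ * Γ.α) = 2 - 2 * ((0 : ℕ) : ℤ) := hg
    rw [Finset.card_univ, hcard, hV, hF]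
    push_cast at hg'
    omega

/-- Every connected planar gluing of the standard vertices comes from a marked graph. -/
theorem IsPlanarGluing.exists_realizes {α : Perm (StdHalfEdge μ)}
    (h : IsPlanarGluing (stdRotation μ) Finset.univ α) :
    ∃ (e : ℕ) (Γ : MarkedGraphOfType e 0 μ), Realizes Γ.1 α := by
  obtain ⟨⟨a1, a2⟩, h2, h3⟩ := h
  have hev : ∃ e, Fintype.card (StdHalfEdge μ) = 2 * e := by
    rw [Finset.card_univ] at h3
    exact ⟨Fintype.card (StdHalfEdge μ) / 2, by omega⟩
  obtain ⟨e, he⟩ := hev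
  -- without half-edges there are no vertices and no faces, and `h3` fails
  have hpos : 0 < e := by
    by_contra hc
    have h0 : Fintype.card (StdHalfEdge μ) = 0 := by omega
    have : IsEmpty (StdHalfEdge μ) := Fintype.card_eq_zero_iff.1 h0
    have hz : ∀ π : Perm (StdHalfEdge μ), cycles π = 0 := fun π => by
      rw [cycles, Nat.card_eq_zero]
      exact Or.inl ⟨fun q => Quotient.inductionOn q fun x => this.elim x⟩
    rw [hz, hz, Finset.card_univ, h0] at h3
    omega
  let ψ : StdHalfEdge μ ≃ Fin (2 * e) := Fintype.equivFinOfCardEq he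
  let σ' : Perm (Fin (2 * e)) := ψ.permCongr (stdRotation μ)
  let α' : Perm (Fin (2 * e)) := ψ.permCongr α
  have hσ : ∀ x, σ' (ψ x) = ψ (stdRotation μ x) := fun x => by simp [σ', permCongr_apply]
  have hα : ∀ x, α' (ψ x) = ψ (α x) := fun x => by simp [α', permCongr_apply]
  have hsc : ∀ x y, (ψ.symm x).1 = (ψ.symm y).1 ↔ SC σ' x y := fun x y => by
    rw [isLabelling_stdRotation]
    have := sameCycle_iff_of_intertwine ψ hσ (ψ.symm x) (ψ.symm y)
    rw [ψ.apply_symm_apply, ψ.apply_symm_apply] at this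
    exact this
  let f : PermCycles σ' → Fin n :=
    Quotient.lift (fun x => (ψ.symm x).1) fun x y hxy => (hsc x y).2 hxy
  have hf : Function.Bijective f := by
    constructor
    · rintro ⟨x⟩ ⟨y⟩ hxy
      exact Quotient.sound ((hsc x y).1 hxy)
    · intro i
      refine ⟨Quotient.mk _ (ψ ⟨i, 0⟩), ?_⟩
      change (ψ.symm (ψ ⟨i, 0⟩)).1 = i
      rw [ψ.symm_apply_apply]
  let Γ : MarkedGraph e n :=
    { α := α'
      σ := σ'
      edges_pos := hpos
      α_involutive := fun x => by
        obtain ⟨x, rfl⟩ := ψ.surjective x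
        rw [hα, hα, a1]
      α_no_fixed_point := fun x => by
        obtain ⟨x, rfl⟩ := ψ.surjective x
        rw [hα]
        exact fun hc => (a2 x).2 (Finset.mem_univ x) (ψ.injective hc)
      transitive := isPretransitive_closure_iff.2 (orbitRel_of_intertwine ψ hσ hα h2)
      mark := Equiv.ofBijective f hf }
  have hlabel : ∀ x, Γ.label (ψ x) = x.1 := fun x => by
    change (ψ.symm (ψ x)).1 = x.1
    rw [ψ.symm_apply_apply]
  refine ⟨e, ⟨Γ, ?_, fun i => ?_⟩, ψ, ⟨hσ, hlabel⟩, hα⟩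
  · have hV := cycles_eq_of_intertwine ψ hσ
    have hF := cycles_eq_of_intertwine ψ (intertwine_inv_mul ψ hσ hα)
    rw [hV, hF, Finset.card_univ, he] at h3
    change (cycles σ' : ℤ) - e + cycles (σ'⁻¹ * α') = 2 - 2 * ((0 : ℕ) : ℤ)
    push_cast
    omega
  · have e1 : {x : StdHalfEdge μ // x.1 = i} ≃ {y // Γ.label y = i} :=
      ψ.subtypeEquiv fun x => by rw [hlabel]
    have e2 : {x : StdHalfEdge μ // x.1 = i} ≃ ZMod (μ i) := Equiv.sigmaSubtype i
    rw [MarkedGraph.degree, ← Nat.card_congr e1, Nat.card_congr e2, Nat.card_zmod]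

/-- The weighted count of planar marked graphs with a chosen half-edge at each vertex is the number
of connected planar gluings of the standard vertices. -/
theorem numC_zero_eq_gluingCount :
    numC 0 μ = gluingCount (stdRotation μ) (Finset.univ : Finset (StdHalfEdge μ)) := by
  classical
  let A : GraphSet 0 μ → Perm (StdHalfEdge μ) → Prop := fun x α =>
    ∃ Γ : MarkedGraphOfType x.1 0 μ, Quotient.mk _ Γ = x.2 ∧ Realizes Γ.1 α
  have hsum : gluingCount (stdRotation μ) (Finset.univ : Finset (StdHalfEdge μ)) =
      ∑ x : GraphSet 0 μ, Nat.card {α // A x α} := by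
    refine card_subtype_eq_sum (fun α => ⟨fun h => ?_, ?_⟩) ?_
    · obtain ⟨e, Γ, hΓ⟩ := h.exists_realizes
      exact ⟨⟨e, Quotient.mk _ Γ⟩, Finset.mem_univ _, Γ, rfl, hΓ⟩
    · rintro ⟨x, -, Γ, -, hΓ⟩
      exact hΓ.isPlanarGluing Γ.2.1
    · rintro ⟨e, q⟩ - ⟨e', q'⟩ - α ⟨(Γ : MarkedGraphOfType e 0 μ), hq, hΓ⟩
        ⟨(Γ' : MarkedGraphOfType e' 0 μ), hq', hΓ'⟩
      change Quotient.mk _ Γ = q at hq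
      change Quotient.mk _ Γ' = q' at hq'
      have hee : e = e' := by
        obtain ⟨ψ, -⟩ := hΓ
        obtain ⟨ψ', -⟩ := hΓ'
        have := Fintype.card_congr (ψ.symm.trans ψ')
        simp only [Fintype.card_fin] at this
        omega
      subst hee
      obtain ⟨φ, hφ⟩ := exists_iso_of_realizes hΓ hΓ'
      rw [← hq, ← hq', Quotient.sound (s := markedIsoSetoid e 0 μ) (a := Γ) (b := Γ') ⟨φ, hφ⟩]
  rw [numC, numD, hsum, Finset.mul_sum]
  push_cast
  refine Finset.sum_congr rfl ?_
  rintro ⟨e, q⟩ -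
  induction q using Quotient.inductionOn with
  | h Γ =>
    have hA : ∀ α, A ⟨e, Quotient.mk _ Γ⟩ α ↔ Realizes Γ.1 α := by
      intro α
      constructor
      · rintro ⟨Γ', hΓ', h⟩
        obtain ⟨φ, hφ⟩ := Quotient.exact hΓ'
        exact h.of_iso hφ
      · exact fun h => ⟨Γ, rfl, h⟩
    have hcard := card_realizes_mul_card_autV Γ.1 Γ.2.2
    simp only [hA]
    change (∏ i, (μ i : ℚ)) * (1 / (Nat.card Γ.1.autV : ℚ)) = _
    have hne : (Nat.card Γ.1.autV : ℚ) ≠ 0 := by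
      exact_mod_cast Nat.card_pos.ne'
    rw [mul_one_div, div_eq_iff hne, ← Nat.cast_prod, ← hcard]
    push_cast
    rfl

end Realize

theorem gFun_eq_weight {a : ℕ} (ha : 1 ≤ a) : gFun a = weight a := by
  have key : ∀ k : ℕ, (2 : ℚ) ^ k * ((2 * k + 1).doubleFactorial : ℚ) / (k.factorial : ℚ) =
      (2 * k + 1) * Nat.centralBinom k := by
    intro k
    have h1 : ((2 * k + 1).factorial : ℚ) =
        (2 * k + 1).doubleFactorial * (2 ^ k * k.factorial) := by
      rw [Nat.factorial_eq_mul_doubleFactorial, Nat.doubleFactorial_two_mul]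
      push_cast
      ring
    have h2 : ((2 * k).factorial : ℚ) = Nat.centralBinom k * k.factorial * k.factorial := by
      have := Nat.choose_mul_factorial_mul_factorial (show k ≤ 2 * k by omega)
      rw [show 2 * k - k = k by omega] at this
      rw [Nat.centralBinom]
      exact_mod_cast this.symm
    have hk : (k.factorial : ℚ) ≠ 0 := by exact_mod_cast k.factorial_ne_zero
    rw [Nat.factorial_succ] at h1
    push_cast at h1
    rw [h2] at h1
    field_simp
    have h3 : (k.factorial : ℚ) * (2 ^ k * ((2 * k + 1).doubleFactorial : ℚ)) =
        k.factorial * ((2 * k + 1) * Nat.centralBinom k * k.factorial) := by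
      linear_combination -h1
    have := mul_left_cancel₀ hk h3
    linear_combination this
  obtain ⟨k, rfl | rfl⟩ := Nat.even_or_odd' a
  · obtain ⟨k, rfl⟩ : ∃ l, k = l + 1 := ⟨k - 1, by omega⟩
    have h1 : 2 * (k + 1) / 2 = k + 1 := by omega
    have h2 : (2 * (k + 1) - 1) / 2 = k := by omega
    rw [gFun, h1, h2, weight_even, pow_succ]
    push_cast
    rw [centralBinom_succ_cast, mul_assoc 2 _ (Nat.centralBinom k : ℚ), ← key]
    ring
  · have h1 : (2 * k + 1) / 2 = k := by omega
    have h2 : (2 * k + 1 - 1) / 2 = k := by omega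
    rw [gFun, h1, h2, weight_odd, key]

end PlanarCount

theorem mainTheorem4 (μ₁ μ₂ μ₃ : ℕ) (h₁ : 1 ≤ μ₁) (h₂ : 1 ≤ μ₂) (h₃ : 1 ≤ μ₃) :
    numC 0 ![μ₁, μ₂, μ₃] =
      1 / 2 * (1 + (-1 : ℚ) ^ (μ₁ + μ₂ + μ₃)) * (gFun μ₁ * gFun μ₂ * gFun μ₃) := by
  have hμ : ∀ i, NeZero (![μ₁, μ₂, μ₃] i) := by
    intro i
    refine ⟨?_⟩
    fin_cases i
    · exact Nat.one_le_iff_ne_zero.1 h₁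
    · exact Nat.one_le_iff_ne_zero.1 h₂
    · exact Nat.one_le_iff_ne_zero.1 h₃
  have : Nonempty (PlanarCount.StdHalfEdge ![μ₁, μ₂, μ₃]) := ⟨⟨0, 0⟩⟩
  have huniv : (Finset.univ : Finset (Fin 3)) = {0, 1, 2} := rfl
  rw [PlanarCount.numC_zero_eq_gluingCount,
    PlanarCount.gluingCount_eq (PlanarCount.planarRecursion_planarFormula (by simp))
      PlanarCount.isLabelling_stdRotation, PlanarCount.image_fst,
    funext PlanarCount.deg_stdRotation, huniv,
    PlanarCount.planarFormula_three (by decide) (by decide) (by decide),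
    PlanarCount.gFun_eq_weight h₁, PlanarCount.gFun_eq_weight h₂, PlanarCount.gFun_eq_weight h₃]
  change PlanarCount.pants μ₁ μ₂ μ₃ = _
  rw [PlanarCount.pants]
  split_ifs with h
  · rw [h.neg_one_pow]
    ring
  · rw [(Nat.not_even_iff_odd.1 h).neg_one_pow]
    ring
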